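/- Let $(\xi,\eta)$ be a random vector with a.s. positive, arbitrarily dependent components, let $(\xi_i,\eta_i)_{i\ge 1}$ be independent copies of $(\xi,\eta)$, and let $T_i:=\xi_1+\dots+\xi_{i-1}+\eta_i$, $i\ge 1$. Consider the general branching process generated by $T=(T_i)_{i\ge1}$: the ancestor is born at time $0$ and her children are born at the times $T_1,T_2,\dots$; for every individual, the shifts of the birth times of her children relative to her own birth time form a copy of $T$, and these copies are independent for different individuals. For $t\ge 0$ and $j\ge 1$ let $N_j(t)$ be the number of individuals of the $j$th generation with birth time at most $t$, and let $V_j(t):=\mathbb{E}N_j(t)$. Assume that the distribution of $\xi$ is nonlattice, that is, not concentrated on any lattice $\{0,d,2d,\dots\}$ with $d>0$, and that $\mathbb{E}\xi^2<\infty$ and $\mathbb{E}\eta<\infty$. Put $m:=\mathbb{E}\xi\in(0,\infty)$ and $b_V:=m^{-1}\big(\mathbb{E}\xi^2/(2m)-\mathbb{E}\eta\big)\in\mathbb{R}$. Then, for every fixed $j\ge 1$, $V_j(t)<\infty$ for all $t\ge0$, and $$\lim_{t\to\infty}\frac{1}{t^{j-1}}\Big(V_j(t)-\frac{t^j}{j!\,m^j}\Big)=\frac{b_V\,j}{(j-1)!\,m^{j-1}}.$$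 In particular, if $b_V\neq 0$, then $$V_j(t)-\frac{t^j}{j!\,m^j}\sim\frac{b_V\,j\,t^{j-1}}{(j-1)!\,m^{j-1}},\qquad t\to\infty,$$ where $f(t)\sim g(t)$ means $\lim_{t\to\infty} f(t)/g(t)=1$. -/

import Mathlib

open MeasureTheory ProbabilityTheory Filter Topology
open scoped ENNReal Nat

noncomputable section

namespace IteratedPerturbedWalk

variable {Ω : Type*}

/-- The perturbed random walk `T_i = ξ_1 + ⋯ + ξ_{i-1} + η_i`, `i ≥ 1`. Indices are shifted to
start at `0`, so that entry `i` is `ξs 0 + ⋯ + ξs (i - 1) + ηs i`. -/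
def perturbedWalk (ξs ηs : ℕ → Ω → ℝ) (ω : Ω) (i : ℕ) : ℝ :=
  (∑ k ∈ Finset.range i, ξs k ω) + ηs i ω

/-- Individuals are words over `ℕ`: `[]` is the ancestor and `i :: u` is child number `i` of `u`.
`X u ω i` is the age of the mother `u` at the birth of her child number `i`. -/
def birthTime (X : List ℕ → Ω → ℕ → ℝ) : List ℕ → Ω → ℝ
  | [], _ => 0
  | i :: u, ω => birthTime X u ω + X u ω i

/-- `N_j(t)`: the number of individuals of generation `j` with birth time at most `t`. -/
def generationCount (X : List ℕ → Ω → ℕ → ℝ) (j : ℕ) (t : ℝ) (ω : Ω) : ℕ∞ :=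
  {u : List ℕ | u.length = j ∧ birthTime X u ω ≤ t}.encard

/-- `V_j(t) = 𝔼 N_j(t)`, as an extended nonnegative real. -/
def meanCount [MeasurableSpace Ω] (μ : Measure Ω) (X : List ℕ → Ω → ℕ → ℝ) (j : ℕ) (t : ℝ) :
    ℝ≥0∞ :=
  ∫⁻ ω, (generationCount X j t ω : ℝ≥0∞) ∂μ

/-- `X` is the family of reproduction processes of a general branching process generated by the
perturbed random walk `T` built from independent copies `(ξs i, ηs i)` of `(ξ, η)`: the ancestor
reproduces according to `T`, every individual according to a copy of `T`, and these copies are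
independent for different individuals. -/
structure IsBranchingProcess [MeasurableSpace Ω] (μ : Measure Ω) (ξ η : Ω → ℝ)
    (ξs ηs : ℕ → Ω → ℝ) (X : List ℕ → Ω → ℕ → ℝ) : Prop where
  steps_identDistrib : ∀ i, IdentDistrib (fun ω => (ξs i ω, ηs i ω)) (fun ω => (ξ ω, η ω)) μ μ
  steps_indep : iIndepFun (fun i ω => (ξs i ω, ηs i ω)) μ
  ancestor : X [] = perturbedWalk ξs ηs
  offspring_identDistrib : ∀ u, IdentDistrib (X u) (perturbedWalk ξs ηs) μ μ
  offspring_indep : iIndepFun X μ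

/-- The distribution of the positive random variable `ξ` is not concentrated on any lattice
`{0, d, 2d, …}` with `d > 0`. -/
def Nonlattice [MeasurableSpace Ω] (μ : Measure Ω) (ξ : Ω → ℝ) : Prop :=
  ∀ d : ℝ, 0 < d → ¬ ∀ᵐ ω ∂μ, ∃ n : ℕ, ξ ω = n * d

/-- `b_V = m⁻¹ (𝔼 ξ² / (2 m) - 𝔼 η)` with `m = 𝔼 ξ`. -/
def bV [MeasurableSpace Ω] (μ : Measure Ω) (ξ η : Ω → ℝ) : ℝ :=
  (∫ ω, ξ ω ∂μ)⁻¹ * ((∫ ω, ξ ω ^ 2 ∂μ) / (2 * ∫ ω, ξ ω ∂μ) - ∫ ω, η ω ∂μ)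

end IteratedPerturbedWalk

end

/-! Let `F`, `G` be the laws of ξ, η. The points of T have intensity measure ν = Σ F^{*i} * G, where
the dependence between ξ and η disappears because T_i uses η_i only with earlier ξ's. Independence
along a line of descent gives V_j(t) = ν^{*j}((-∞, t]) (`IsBranchingProcess.meanCount_eq`), and the
Laplace transform at 1, multiplicative under convolution, shows that this is finite.

The analytic core is the case j = 1: the excess e(t) = V(t) - t⁺/m tends to b_V
(`IsRenewal.tendsto_excess`). It is proved here without Blackwell's theorem. Let W be the primitive
of e. Integrating the renewal equation gives an explicit Z(t) = W(t) - ∫ W(t-x) F(dx), and Z(t) → E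
ξ²/(2m) - E η. Since W(t) - W(t-x) is about x e(t), Z(t) differs from m e(t) by a bounded amount, so
e is bounded. Sliding averages of e are then bounded, Lipschitz and asymptotically harmonic for F. A
Choquet–Deny type argument (`tendsto_increment_zero`) makes them slowly varying, and because e falls
at rate at most 1/m, e is slowly varying too. Hence Z(t) - m e(t) → 0, which identifies the limit of
e.

For general j, `IsRenewal.tendsto_conv` convolves a two-term expansion with ν. Induction closes
because αb + c/((k+1)m) turns the coefficients for j = k+1 into those for j = k+2. -/

/-! ### Asymptotically harmonic functions for a nonlattice step law -/

namespace IteratedPerturbedWalk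

/-- The support of a nonlattice law on the positive half-line generates a dense subgroup. -/
theorem dense_closure_support {F : Measure ℝ} [IsProbabilityMeasure F]
    (hpos : ∀ᵐ x ∂F, 0 < x) (hnl : ∀ d : ℝ, 0 < d → ¬ ∀ᵐ x ∂F, ∃ n : ℕ, x = n * d) :
    Dense (AddSubgroup.closure F.support : Set ℝ) := by
  rcases AddSubgroup.dense_or_cyclic (AddSubgroup.closure F.support) with h | ⟨a, ha⟩
  · exact h
  exfalso
  have hmem : ∀ᵐ x ∂F, ∃ k : ℤ, x = k * a := by
    filter_upwards [Measure.support_mem_ae (μ := F)] with x hx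
    have : x ∈ AddSubgroup.closure F.support := AddSubgroup.subset_closure hx
    rw [ha, AddSubgroup.mem_closure_singleton] at this
    obtain ⟨k, hk⟩ := this
    exact ⟨k, by rw [← hk]; simp⟩
  by_cases ha0 : a = 0
  · have : ∀ᵐ x ∂F, False := by
      filter_upwards [hmem, hpos] with x ⟨k, hk⟩ hx
      simp [ha0] at hk
      linarith
    simp at this
    exact IsProbabilityMeasure.ne_zero F this
  · refine hnl |a| (abs_pos.2 ha0) ?_
    filter_upwards [hmem, hpos] with x ⟨k, hk⟩ hx
    -- Since x = ka is positive, x = |k||a|, so the signs of k and a are irrelevant.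
    refine ⟨k.natAbs, ?_⟩
    rw [Nat.cast_natAbs, Int.cast_abs, ← abs_mul, ← hk, abs_of_pos hx]

theorem integrable_bounded_shift {F : Measure ℝ} [IsFiniteMeasure F] {g : ℝ → ℝ} {M : ℝ}
    (hM : ∀ t, |g t| ≤ M) (hg : Measurable g) (t : ℝ) : Integrable (fun x => g (t - x)) F :=
  Integrable.of_bound (by fun_prop : Measurable fun x => g (t - x)).aestronglyMeasurable M (Eventually.of_forall fun x => hM _)

/-- If an asymptotically harmonic function tends to its upper limit along a sequence, then it
does so along the sequence shifted back by a point of the support. -/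
theorem tendsto_sub_of_mem_support {F : Measure ℝ} [IsProbabilityMeasure F] {D : ℝ → ℝ} {M : ℝ}
    (hM : ∀ t, |D t| ≤ M) {K : NNReal} (hK : LipschitzWith K D)
    (hD : Tendsto (fun t => D t - ∫ x, D (t - x) ∂F) atTop (𝓝 0)) {L : ℝ}
    (hL : ∀ ε > 0, ∀ᶠ t in atTop, D t < L + ε) {s : ℕ → ℝ} (hs : Tendsto s atTop atTop)
    (hsL : Tendsto (fun n => D (s n)) atTop (𝓝 L)) {y : ℝ} (hy : y ∈ F.support) :
    Tendsto (fun n => D (s n - y)) atTop (𝓝 L) := by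
  have hmD : Measurable D := hK.continuous.measurable
  have hint : ∀ t, Integrable (fun x => D (t - x)) F := integrable_bounded_shift hM hmD
  have h1 : Tendsto (fun n => ∫ x, (L - D (s n - x)) ∂F) atTop (𝓝 0) := by
    have h := hsL.sub (hD.comp hs)
    simp only [Function.comp_def, sub_zero, sub_sub_cancel] at h
    have h' := (tendsto_const_nhds (x := L)).sub h
    rw [sub_self] at h'
    refine h'.congr fun n => ?_
    rw [integral_sub (integrable_const _) (hint _)]
    simp
  -- By `h1` the mean of L - D(s_n - x) vanishes in the limit. The overshoot above L vanishes as
  -- well, since L is an asymptotic upper bound; as |u| = u + 2u⁻, convergence holds in L¹(F).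
  have h2 : Tendsto (fun n => ∫ x, max (D (s n - x) - L) 0 ∂F) atTop (𝓝 0) := by
    suffices h : Tendsto (fun n => ∫ x, max (D (s n - x) - L) 0 ∂F) atTop
        (𝓝 (∫ _ : ℝ, (0 : ℝ) ∂F)) by rwa [integral_zero] at h
    refine tendsto_integral_of_dominated_convergence (fun _ => M + |L|) ?_ (integrable_const _) ?_ ?_
    · intro n
      exact (by fun_prop : Measurable _).aestronglyMeasurable
    · intro n
      refine Eventually.of_forall fun x => ?_
      have h1 := abs_le.1 (hM (s n - x))
      have h2 := neg_abs_le L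
      have h3 := abs_nonneg L
      rw [Real.norm_of_nonneg (le_max_right _ _)]
      exact max_le (by linarith) (by linarith [h1.1, h1.2])
    · refine Eventually.of_forall fun x => ?_
      rw [Metric.tendsto_atTop]
      intro ε hε
      have hsx : Tendsto (fun n => s n - x) atTop atTop := tendsto_atTop_add_const_right _ _ hs
      obtain ⟨N, hN⟩ := eventually_atTop.1 (hsx.eventually (hL ε hε))
      refine ⟨N, fun n hn => ?_⟩
      rw [Real.dist_eq, sub_zero, abs_of_nonneg (le_max_right _ _)]
      exact max_lt (by linarith [hN n hn]) hε
  have h3 : Tendsto (fun n => ∫ x, |L - D (s n - x)| ∂F) atTop (𝓝 0) := by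
    have h := h1.add (h2.const_mul 2)
    simp only [mul_zero, add_zero] at h
    refine h.congr fun n => ?_
    rw [← integral_const_mul, ← integral_add (f := fun x => L - D (s n - x))
      ((integrable_const _).sub (hint _))]
    · refine integral_congr_ae (Eventually.of_forall fun x => ?_)
      simp only
      rcases le_total (D (s n - x)) L with h | h
      · rw [max_eq_right (by linarith), abs_of_nonneg (by linarith)]; ring
      · rw [max_eq_left (by linarith), abs_of_nonpos (by linarith)]; ring
    · exact (((hint _).sub (integrable_const _)).pos_part).const_mul 2
  rw [Metric.tendsto_atTop]
  intro ε hε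
  -- On the ball of radius δ the function moves by at most ε/2, so a deviation of at least ε at y
  -- forces one of at least ε/2 on a set of positive mass, against L¹ convergence.
  set δ : ℝ := ε / (2 * (K + 1)) with hδ
  have hKp : (0 : ℝ) < K + 1 := by positivity
  have hδp : 0 < δ := by positivity
  have hp : 0 < F.real (Metric.ball y δ) := by
    have := Measure.mem_support_iff_forall y |>.1 hy (Metric.ball y δ) (Metric.ball_mem_nhds y hδp)
    rw [measureReal_def]
    exact ENNReal.toReal_pos this.ne' (measure_ne_top _ _)
  obtain ⟨N, hN⟩ := Metric.tendsto_atTop.1 h3 (F.real (Metric.ball y δ) * (ε / 2)) (by positivity)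
  refine ⟨N, fun n hn => ?_⟩
  have hI := hN n hn
  rw [Real.dist_eq, sub_zero, abs_of_nonneg (integral_nonneg fun x => abs_nonneg _)] at hI
  rw [Real.dist_eq, abs_sub_comm]
  by_contra! hcon
  have hle : ∫ x, (Metric.ball y δ).indicator (fun _ => ε / 2) x ∂F ≤ ∫ x, |L - D (s n - x)| ∂F := by
    refine integral_mono ((integrable_const _).indicator Metric.isOpen_ball.measurableSet)
      ((integrable_const _).sub (hint _)).abs fun x => ?_
    by_cases hx : x ∈ Metric.ball y δ
    · rw [Set.indicator_of_mem hx]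
      have hl := hK.dist_le_mul (s n - x) (s n - y)
      rw [Real.dist_eq, Real.dist_eq, sub_sub_sub_cancel_left] at hl
      rw [Metric.mem_ball, dist_comm, Real.dist_eq] at hx
      have h4 : (K : ℝ) * |y - x| ≤ ε / 2 := by
        calc (K : ℝ) * |y - x| ≤ (K + 1) * δ := by gcongr; linarith
          _ = ε / 2 := by rw [hδ]; field_simp
      have h5 := abs_add_le (L - D (s n - x)) (D (s n - x) - D (s n - y))
      rw [sub_add_sub_cancel] at h5
      linarith
    · rw [Set.indicator_of_notMem hx]
      exact abs_nonneg _
  rw [integral_indicator Metric.isOpen_ball.measurableSet, setIntegral_const, smul_eq_mul] at hle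
  linarith

/-- Positive and negative generators can be collected separately. This is needed because limits are
transported only by backward shifts, that is, by elements of the monoid. -/
theorem exists_eq_sub_of_mem_closure {S : Set ℝ} {g : ℝ} (hg : g ∈ AddSubgroup.closure S) :
    ∃ p ∈ AddSubmonoid.closure S, ∃ q ∈ AddSubmonoid.closure S, g = p - q := by
  induction hg using AddSubgroup.closure_induction with
  | mem x hx => exact ⟨x, AddSubmonoid.subset_closure hx, 0, zero_mem _, by simp⟩
  | zero => exact ⟨0, zero_mem _, 0, zero_mem _, by simp⟩
  | add x y _ _ hx hy =>
    obtain ⟨p, hp, q, hq, rfl⟩ := hx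
    obtain ⟨p', hp', q', hq', rfl⟩ := hy
    exact ⟨p + p', add_mem hp hp', q + q', add_mem hq hq', by ring⟩
  | neg x _ hx =>
    obtain ⟨p, hp, q, hq, rfl⟩ := hx
    exact ⟨q, hq, p, hp, by ring⟩

/-- A bounded Lipschitz function that is asymptotically harmonic for a nonlattice positive step
law has increments with nonpositive upper limit. -/
theorem eventually_increment_lt {F : Measure ℝ} [IsProbabilityMeasure F]
    (hpos : ∀ᵐ x ∂F, 0 < x) (hnl : ∀ d : ℝ, 0 < d → ¬ ∀ᵐ x ∂F, ∃ n : ℕ, x = n * d)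
    {g : ℝ → ℝ} {M : ℝ} (hM : ∀ t, |g t| ≤ M) {K : NNReal} (hK : LipschitzWith K g)
    (hg : Tendsto (fun t => g t - ∫ x, g (t - x) ∂F) atTop (𝓝 0)) (a : ℝ) {ε : ℝ} (hε : 0 < ε) :
    ∀ᶠ t in atTop, g (t + a) - g t < ε := by
  by_contra hcon
  set D : ℝ → ℝ := fun t => g (t + a) - g t with hDdef
  have hmg : Measurable g := hK.continuous.measurable
  have hDM : ∀ t, |D t| ≤ 2 * M := fun t => by
    have h1 := abs_le.1 (hM t)
    have h2 := abs_le.1 (hM (t + a))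
    exact abs_le.2 ⟨by simp only [hDdef]; linarith, by simp only [hDdef]; linarith⟩
  have hDK : LipschitzWith (K + K) D := by
    have h1 : LipschitzWith K (fun t => g (t + a)) := by
      have h := hK.comp (LipschitzWith.id.add (LipschitzWith.const a))
      rw [add_zero, mul_one] at h
      exact h
    exact h1.sub hK
  have hDharm : Tendsto (fun t => D t - ∫ x, D (t - x) ∂F) atTop (𝓝 0) := by
    have h := (hg.comp (tendsto_atTop_add_const_right atTop a tendsto_id)).sub hg
    rw [sub_zero] at h
    refine h.congr fun t => ?_
    simp only [hDdef, Function.comp_def, id]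
    rw [integral_sub]
    · simp only [sub_add_eq_add_sub]; ring
    · simpa only [sub_add_eq_add_sub] using integrable_bounded_shift hM hmg (t + a)
    · exact integrable_bounded_shift hM hmg t
  have hbdd : IsBoundedUnder (· ≤ ·) atTop D :=
    isBoundedUnder_of ⟨2 * M, fun t => (abs_le.1 (hDM t)).2⟩
  have hcobdd : IsCoboundedUnder (· ≤ ·) atTop D :=
    (isBoundedUnder_of ⟨-(2 * M), fun t => (abs_le.1 (hDM t)).1⟩ :
      IsBoundedUnder (· ≥ ·) atTop D).isCoboundedUnder_le
  set L := limsup D atTop with hLdef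
  have hLpos : 0 < L := by
    refine hε.trans_le (le_limsup_of_frequently_le ?_ hbdd)
    simpa [Filter.Frequently, not_le] using hcon
  have hup : ∀ ε > 0, ∀ᶠ t in atTop, D t < L + ε := fun η hη =>
    eventually_lt_of_limsup_lt (by linarith) hbdd
  have hfreq : ∀ n : ℕ, ∃ t ≥ (n : ℝ), L - 1 / ((n : ℝ) + 1) < D t := fun n =>
    (frequently_atTop.1 (frequently_lt_of_lt_limsup hcobdd
      (sub_lt_self _ (by positivity) : L - 1 / ((n : ℝ) + 1) < limsup D atTop))) n
  choose s hsn hsD using hfreq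
  have hs : Tendsto s atTop atTop := tendsto_atTop_mono hsn tendsto_natCast_atTop_atTop
  have hsL : Tendsto (fun n => D (s n)) atTop (𝓝 L) := by
    refine tendsto_order.2 ⟨fun l hl => ?_, fun l hl => ?_⟩
    · have h : Tendsto (fun n : ℕ => L - 1 / ((n : ℝ) + 1)) atTop (𝓝 (L - 0)) :=
        tendsto_const_nhds.sub tendsto_one_div_add_atTop_nhds_zero_nat
      rw [sub_zero] at h
      filter_upwards [h.eventually (lt_mem_nhds hl)] with n hn
      exact hn.trans (hsD n)
    · have := hs.eventually (hup (l - L) (by linarith))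
      filter_upwards [this] with n hn
      linarith
  have hmon : ∀ p ∈ AddSubmonoid.closure F.support, ∀ s : ℕ → ℝ, Tendsto s atTop atTop →
      Tendsto (fun n => D (s n)) atTop (𝓝 L) → Tendsto (fun n => D (s n - p)) atTop (𝓝 L) := by
    intro p hp
    induction hp using AddSubmonoid.closure_induction with
    | mem y hy => exact fun s hs hsL => tendsto_sub_of_mem_support hDM hDK hDharm hup hs hsL hy
    | zero => intro s hs hsL; simpa using hsL
    | add x y _ _ hx hy =>
      intro s hs hsL
      have := hy (fun n => s n - x) (tendsto_atTop_add_const_right _ (-x) hs) (hx s hs hsL)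
      simpa only [sub_sub] using this
  -- N consecutive increments of size L/2 would exceed 2M, the largest possible oscillation of g.
  obtain ⟨N, hN⟩ := exists_nat_gt (2 * M / (L / 2))
  have hN' : 2 * M < N * (L / 2) := (div_lt_iff₀ (by linarith)).1 hN
  -- Replacing ka by a group element within δ changes D by at most L/4, so a value above 3L/4 stays
  -- above L/2.
  set δ : ℝ := L / (4 * ((K + K : NNReal) + 1)) with hδ
  have hKp : (0 : ℝ) < (K + K : NNReal) + 1 := by positivity
  have hδp : 0 < δ := by positivity
  have hdense := dense_closure_support hpos hnl
  have hgk : ∀ k : ℕ, ∃ γ ∈ AddSubgroup.closure F.support, dist ((k : ℝ) * a) γ < δ := fun k => by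
    obtain ⟨γ, h1, h2⟩ := Metric.dense_iff.1 hdense ((k : ℝ) * a) δ hδp
    exact ⟨γ, h2, by rw [dist_comm]; exact h1⟩
  choose γ hγ hγd using hgk
  choose p hp q hq hpq using fun k => exists_eq_sub_of_mem_closure (hγ k)
  -- Shifting back by the sum of all p_k makes every -P + γ_k the negative of a monoid element, so a
  -- single sequence serves all k < N at once.
  set P := ∑ k ∈ Finset.range N, p k with hP
  have hlim : ∀ k ∈ Finset.range N, Tendsto (fun n => D (s n - P + γ k)) atTop (𝓝 L) := by
    intro k hk
    have hsum : P = p k + ∑ i ∈ (Finset.range N).erase k, p i := (Finset.add_sum_erase _ _ hk).symm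
    have hmem : (∑ i ∈ (Finset.range N).erase k, p i) + q k ∈ AddSubmonoid.closure F.support :=
      add_mem (AddSubmonoid.sum_mem _ fun i _ => hp i) (hq k)
    refine (hmon _ hmem s hs hsL).congr fun n => ?_
    congr 1
    rw [hsum, hpq k]; ring
  have hev : ∀ᶠ n in atTop, ∀ k ∈ Finset.range N, L / 2 < D (s n - P + k * a) := by
    rw [Filter.eventually_all_finset]
    intro k hk
    have h34 : 3 * L / 4 < L := by linarith
    filter_upwards [(hlim k hk).eventually (lt_mem_nhds h34)] with n hn
    have hl := hDK.dist_le_mul (s n - P + γ k) (s n - P + k * a)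
    rw [dist_add_left, dist_comm (γ k)] at hl
    have h4 : ((K + K : NNReal) : ℝ) * dist ((k : ℝ) * a) (γ k) ≤ L / 4 := by
      calc ((K + K : NNReal) : ℝ) * dist ((k : ℝ) * a) (γ k) ≤ ((K + K : NNReal) + 1) * δ := by
            gcongr
            · linarith
            · exact (hγd k).le
        _ = L / 4 := by rw [hδ]; field_simp
    have h5 := (abs_le.1 ((Real.dist_eq _ _).symm.le.trans (hl.trans h4))).2
    linarith
  obtain ⟨n, hn⟩ := hev.exists
  have htel : ∑ k ∈ Finset.range N, D (s n - P + k * a) = g (s n - P + N * a) - g (s n - P) := by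
    have := Finset.sum_range_sub (fun k : ℕ => g (s n - P + k * a)) N
    simp only [Nat.cast_zero, zero_mul, add_zero] at this
    rw [← this]
    refine Finset.sum_congr rfl fun k _ => ?_
    simp only [hDdef]
    push_cast
    ring_nf
  have hge : N * (L / 2) ≤ ∑ k ∈ Finset.range N, D (s n - P + k * a) := by
    have := Finset.card_nsmul_le_sum (Finset.range N) (fun k : ℕ => D (s n - P + k * a)) (L / 2)
      fun k hk => (hn k hk).le
    simpa using this
  have h1 := abs_le.1 (hM (s n - P + N * a))
  have h2 := abs_le.1 (hM (s n - P))
  linarith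

/-- A bounded Lipschitz function that is asymptotically harmonic for a nonlattice positive step
law is slowly varying. -/
theorem tendsto_increment_zero {F : Measure ℝ} [IsProbabilityMeasure F]
    (hpos : ∀ᵐ x ∂F, 0 < x) (hnl : ∀ d : ℝ, 0 < d → ¬ ∀ᵐ x ∂F, ∃ n : ℕ, x = n * d)
    {g : ℝ → ℝ} {M : ℝ} (hM : ∀ t, |g t| ≤ M) {K : NNReal} (hK : LipschitzWith K g)
    (hg : Tendsto (fun t => g t - ∫ x, g (t - x) ∂F) atTop (𝓝 0)) (a : ℝ) :
    Tendsto (fun t => g (t + a) - g t) atTop (𝓝 0) := by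
  have hneg : Tendsto (fun t => -g t - ∫ x, -g (t - x) ∂F) atTop (𝓝 0) := by
    have h := hg.neg
    rw [neg_zero] at h
    refine h.congr fun t => ?_
    rw [integral_neg]; ring
  refine tendsto_order.2 ⟨fun l hl => ?_, fun l hl => eventually_increment_lt hpos hnl hM hK hg a hl⟩
  filter_upwards [eventually_increment_lt (g := fun t => -g t) hpos hnl
    (fun t => by rw [abs_neg]; exact hM t) hK.neg hneg a (neg_pos.2 hl)] with t ht
  linarith

end IteratedPerturbedWalk

/-! ### The renewal equation and its integrated form -/

namespace IteratedPerturbedWalk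

/-- `V` is a nondecreasing solution, vanishing on the negative half-line, of the renewal equation
with step law `F` and inhomogeneity the distribution function of `G`. -/
structure IsRenewal (F G : Measure ℝ) (V : ℝ → ℝ) : Prop where
  step_pos : ∀ᵐ x ∂F, 0 < x
  step_sq : Integrable (fun x : ℝ => x ^ 2) F
  delay_pos : ∀ᵐ y ∂G, 0 < y
  delay_int : Integrable (fun y : ℝ => y) G
  mono : Monotone V
  zero : ∀ t < 0, V t = 0
  eq : ∀ t, V t = G.real (Set.Iic t) + ∫ x, V (t - x) ∂F

namespace IsRenewal

variable {F G : Measure ℝ} {V : ℝ → ℝ}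

theorem nonneg (h : IsRenewal F G V) (t : ℝ) : 0 ≤ V t := by
  have h1 := h.zero (min t 0 - 1) (by linarith [min_le_right t 0])
  rw [← h1]
  exact h.mono (by linarith [min_le_left t 0])

theorem measurable (h : IsRenewal F G V) : Measurable V := h.mono.measurable

theorem intervalIntegrable (h : IsRenewal F G V) (a b : ℝ) : IntervalIntegrable V volume a b :=
  h.mono.intervalIntegrable

theorem step_int [IsProbabilityMeasure F] (h : IsRenewal F G V) :
    Integrable (fun x : ℝ => x) F := by
  refine Integrable.mono' ((integrable_const 1).add h.step_sq) measurable_id.aestronglyMeasurable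
    (Eventually.of_forall fun x => ?_)
  rw [Real.norm_eq_abs, Pi.add_apply, ← sq_abs]
  nlinarith [sq_nonneg (|x| - 1), abs_nonneg x]

theorem mean_pos [IsProbabilityMeasure F] (h : IsRenewal F G V) : 0 < ∫ x, x ∂F := by
  rw [integral_pos_iff_support_of_nonneg_ae (h.step_pos.mono fun x hx => hx.le) h.step_int]
  have : Function.support (fun x : ℝ => x) ∈ ae F := by
    filter_upwards [h.step_pos] with x hx using hx.ne'
  rw [measure_congr (eventuallyEq_univ.2 this), measure_univ]
  exact one_pos

theorem integrable_shift [IsProbabilityMeasure F] (h : IsRenewal F G V) (t : ℝ) :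
    Integrable (fun x => V (t - x)) F := by
  refine Integrable.of_bound (h.measurable.comp (by fun_prop)).aestronglyMeasurable (V t) ?_
  filter_upwards [h.step_pos] with x hx
  rw [Real.norm_of_nonneg (h.nonneg _)]
  exact h.mono (by linarith)

/-- Increments over intervals of bounded length are bounded. -/
theorem exists_increment_le [IsProbabilityMeasure F] [IsProbabilityMeasure G]
    (h : IsRenewal F G V) :
    ∃ C : ℝ, 0 ≤ C ∧ ∀ t x, 0 ≤ x → V t - V (t - x) ≤ C * (1 + x) := by
  obtain ⟨a, ha, hp⟩ : ∃ a : ℝ, 0 < a ∧ 0 < F.real (Set.Ici a) := by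
    by_contra! hcon
    have h0 : ∀ n : ℕ, ∀ᵐ x ∂F, x < 1 / ((n : ℝ) + 1) := fun n => by
      have h1 := le_antisymm (hcon (1 / ((n : ℝ) + 1)) (by positivity)) measureReal_nonneg
      rw [measureReal_eq_zero_iff] at h1
      filter_upwards [measure_eq_zero_iff_ae_notMem.1 h1] with x hx
      simpa using hx
    have : ∀ᵐ x ∂F, False := by
      filter_upwards [ae_all_iff.2 h0, h.step_pos] with x hx hx0
      obtain ⟨n, hn⟩ := exists_nat_one_div_lt hx0
      exact absurd (hx n) (not_lt.2 hn.le)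
    simp at this
    exact IsProbabilityMeasure.ne_zero F this
  set p := F.real (Set.Ici a) with hpdef
  have hone : ∀ t, V t - V (t - a) ≤ 1 / p := by
    intro t
    rw [le_div_iff₀ hp]
    -- Steps of length at least a have probability p and cost at least V(t) - V(t-a). The renewal
    -- equation then gives V(t) ≤ 1 + V(t) - p(V(t) - V(t-a)).
    have h1 : ∫ x, V (t - x) ∂F ≤
        ∫ x, (V t - (Set.Ici a).indicator (fun _ => V t - V (t - a)) x) ∂F := by
      refine integral_mono_ae (h.integrable_shift t) ((integrable_const _).sub
        ((integrable_const _).indicator measurableSet_Ici)) ?_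
      filter_upwards [h.step_pos] with x hx
      by_cases hxa : x ∈ Set.Ici a
      · rw [Set.indicator_of_mem hxa, sub_sub_cancel]
        exact h.mono (by linarith [Set.mem_Ici.1 hxa])
      · rw [Set.indicator_of_notMem hxa, sub_zero]
        exact h.mono (by linarith)
    rw [integral_sub (integrable_const _) ((integrable_const _).indicator measurableSet_Ici),
      integral_indicator measurableSet_Ici, setIntegral_const] at h1
    simp only [integral_const, probReal_univ, smul_eq_mul] at h1
    have h2 := h.eq t
    have h3 : G.real (Set.Iic t) ≤ 1 := measureReal_le_one
    linarith
  have hn : ∀ (n : ℕ) t, V t - V (t - n * a) ≤ n * (1 / p) := by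
    intro n
    induction n with
    | zero => intro t; simp
    | succ n ih =>
      intro t
      have h1 := ih t
      have h2 := hone (t - n * a)
      have h3 : t - ((n + 1 : ℕ) : ℝ) * a = t - n * a - a := by push_cast; ring
      rw [h3]; push_cast; linarith
  refine ⟨(1 / a + 1) * (1 / p), by positivity, fun t x hx => ?_⟩
  have h1 := Nat.le_ceil (x / a)
  have h2 := (Nat.ceil_lt_add_one (a := x / a) (by positivity)).le
  rw [div_le_iff₀ ha] at h1
  calc V t - V (t - x) ≤ V t - V (t - ⌈x / a⌉₊ * a) := by
        gcongr; exact h.mono (by linarith)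
    _ ≤ ⌈x / a⌉₊ * (1 / p) := hn _ _
    _ ≤ (x / a + 1) * (1 / p) := by gcongr
    _ ≤ ((1 / a + 1) * (1 + x)) * (1 / p) := by
        gcongr
        have : 0 < 1 / a := by positivity
        rw [div_eq_mul_one_div]
        nlinarith
    _ = _ := by ring

theorem integral_of_nonpos (h : IsRenewal F G V) {t : ℝ} (ht : t ≤ 0) : ∫ s in (0 : ℝ)..t, V s = 0 := by
  rw [intervalIntegral.integral_symm, intervalIntegral.integral_of_le ht,
    ← integral_Ico_eq_integral_Ioc, setIntegral_eq_zero_of_forall_eq_zero, neg_zero]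
  exact fun s hs => h.zero s hs.2

/-- The integrated renewal equation. -/
theorem integral_eq [IsProbabilityMeasure F] [IsProbabilityMeasure G]
    (h : IsRenewal F G V) {t : ℝ} (ht : 0 ≤ t) :
    ∫ s in (0 : ℝ)..t, V s =
      ∫ y, max (t - y) 0 ∂G + ∫ x, (∫ s in (0 : ℝ)..(t - x), V s) ∂F := by
  set ρ := (volume : Measure ℝ).restrict (Set.Ioc 0 t) with hρ
  have hmem : ∀ᵐ s ∂ρ, s ∈ Set.Ioc 0 t := ae_restrict_mem measurableSet_Ioc
  have hF : Integrable (Function.uncurry fun s x => V (s - x)) (ρ.prod F) := by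
    refine Integrable.of_bound (h.measurable.comp (by fun_prop)).aestronglyMeasurable (V t) ?_
    filter_upwards [Measure.quasiMeasurePreserving_fst.ae hmem,
      Measure.quasiMeasurePreserving_snd.ae h.step_pos] with z hz1 hz2
    rw [Function.uncurry, Real.norm_of_nonneg (h.nonneg _)]
    exact h.mono (by linarith [hz1.2])
  have hset : MeasurableSet {z : ℝ × ℝ | z.2 ≤ z.1} := measurableSet_le measurable_snd measurable_fst
  have hG : Integrable (Function.uncurry fun s y => (Set.Ici y).indicator (fun _ => (1 : ℝ)) s)
      (ρ.prod G) := by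
    have : (Function.uncurry fun s y => (Set.Ici y).indicator (fun _ => (1 : ℝ)) s) =
        {z : ℝ × ℝ | z.2 ≤ z.1}.indicator fun _ => 1 := by
      ext z; simp [Function.uncurry, Set.indicator]
    rw [this]
    exact (integrable_const _).indicator hset
  have hGeq : ∀ s, G.real (Set.Iic s) = ∫ y, (Set.Ici y).indicator (fun _ => (1 : ℝ)) s ∂G := by
    intro s
    have : (fun y => (Set.Ici y).indicator (fun _ => (1 : ℝ)) s) =
        (Set.Iic s).indicator fun _ => 1 := by
      ext z; simp [Set.indicator]
    rw [this, integral_indicator measurableSet_Iic]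
    simp
  -- Fubini in both terms: the indicator of y ≤ s integrates to (t-y)⁺, and the shifted V to its
  -- primitive at t-x, the part over negative arguments being zero.
  calc ∫ s in (0 : ℝ)..t, V s
      = ∫ s, (∫ y, (Set.Ici y).indicator (fun _ => (1 : ℝ)) s ∂G + ∫ x, V (s - x) ∂F) ∂ρ := by
        rw [intervalIntegral.integral_of_le ht]
        refine integral_congr_ae (Eventually.of_forall fun s => ?_)
        simp only
        rw [← hGeq, ← h.eq]
    _ = ∫ s, (∫ y, (Set.Ici y).indicator (fun _ => (1 : ℝ)) s ∂G) ∂ρ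
          + ∫ s, (∫ x, V (s - x) ∂F) ∂ρ := integral_add hG.integral_prod_left hF.integral_prod_left
    _ = ∫ y, (∫ s, (Set.Ici y).indicator (fun _ => (1 : ℝ)) s ∂ρ) ∂G
          + ∫ x, (∫ s, V (s - x) ∂ρ) ∂F := by
        rw [integral_integral_swap hG, integral_integral_swap hF]
    _ = _ := by
        congr 1
        · refine integral_congr_ae ?_
          filter_upwards [h.delay_pos] with y hy
          rw [integral_indicator measurableSet_Ici, setIntegral_const, hρ,
            measureReal_restrict_apply measurableSet_Ici]
          have : Set.Ici y ∩ Set.Ioc 0 t = Set.Icc y t := by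
            ext s
            simp only [Set.mem_inter_iff, Set.mem_Ici, Set.mem_Ioc, Set.mem_Icc]
            exact ⟨fun h => ⟨h.1, h.2.2⟩, fun h => ⟨h.1, by linarith, h.2⟩⟩
          rw [this, measureReal_def, Real.volume_Icc, smul_eq_mul, mul_one,
            ENNReal.toReal_ofReal']
        · refine integral_congr_ae ?_
          filter_upwards [h.step_pos] with x hx
          rw [hρ, ← intervalIntegral.integral_of_le ht, intervalIntegral.integral_comp_sub_right,
            ← intervalIntegral.integral_interval_sub_left (h.intervalIntegrable 0 _)
              (h.intervalIntegrable 0 _), h.integral_of_nonpos (t := 0 - x) (by linarith), sub_zero]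

end IsRenewal
end IteratedPerturbedWalk

/-! ### Boundedness of the excess -/

namespace IteratedPerturbedWalk

noncomputable section

/-- The deviation `V(t) - t⁺ / m` of a renewal function from its linear approximation. -/
def excess (F : Measure ℝ) (V : ℝ → ℝ) (t : ℝ) : ℝ := V t - max t 0 / ∫ x, x ∂F

end

theorem integral_max_zero (t : ℝ) : ∫ s in (0 : ℝ)..t, max s 0 = (max t 0) ^ 2 / 2 := by
  rcases le_total 0 t with ht | ht
  · rw [max_eq_left ht, intervalIntegral.integral_congr (g := fun s => s), integral_id]
    · ring
    · intro s hs
      rw [Set.uIcc_of_le ht] at hs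
      exact max_eq_left hs.1
  · rw [max_eq_right ht, intervalIntegral.integral_congr (g := fun s => 0)]
    · simp
    · intro s hs
      rw [Set.uIcc_of_ge ht] at hs
      exact max_eq_right hs.2

namespace IsRenewal

variable {F G : Measure ℝ} {V : ℝ → ℝ}

theorem measurable_excess (h : IsRenewal F G V) : Measurable (excess F V) :=
  h.measurable.sub (by fun_prop)

theorem intervalIntegrable_excess (h : IsRenewal F G V) (a b : ℝ) :
    IntervalIntegrable (excess F V) volume a b :=
  (h.intervalIntegrable a b).sub ((by fun_prop : Continuous fun t : ℝ =>
    max t 0 / ∫ x, x ∂F).intervalIntegrable a b)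

theorem integral_excess (h : IsRenewal F G V) (t : ℝ) :
    ∫ s in (0 : ℝ)..t, excess F V s =
      (∫ s in (0 : ℝ)..t, V s) - (max t 0) ^ 2 / (2 * ∫ x, x ∂F) := by
  unfold excess
  rw [intervalIntegral.integral_sub (h.intervalIntegrable 0 t)
    ((by fun_prop : Continuous fun t : ℝ => max t 0 / ∫ x, x ∂F).intervalIntegrable 0 t),
    intervalIntegral.integral_div, integral_max_zero, div_div]

theorem continuous_integral_excess (h : IsRenewal F G V) :
    Continuous fun t => ∫ s in (0 : ℝ)..t, excess F V s :=
  intervalIntegral.continuous_primitive (fun a b => h.intervalIntegrable_excess a b) 0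

theorem integral_excess_sub (h : IsRenewal F G V) (a b : ℝ) :
    (∫ s in (0 : ℝ)..b, excess F V s) - (∫ s in (0 : ℝ)..a, excess F V s) =
      ∫ s in a..b, excess F V s :=
  intervalIntegral.integral_interval_sub_left (h.intervalIntegrable_excess 0 b)
    (h.intervalIntegrable_excess 0 a)

theorem integrable_integral_shift [IsProbabilityMeasure F] (h : IsRenewal F G V) {t : ℝ}
    (ht : 0 ≤ t) : Integrable (fun x => ∫ s in (0 : ℝ)..(t - x), V s) F := by
  have hc : Continuous fun t => ∫ s in (0 : ℝ)..t, V s :=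
    intervalIntegral.continuous_primitive (fun a b => h.intervalIntegrable a b) 0
  refine Integrable.of_bound (hc.comp (by fun_prop)).aestronglyMeasurable (V t * t) ?_
  filter_upwards [h.step_pos] with x hx
  rcases le_total (t - x) 0 with hx0 | hx0
  · rw [h.integral_of_nonpos hx0, norm_zero]
    exact mul_nonneg (h.nonneg t) ht
  · refine (intervalIntegral.norm_integral_le_of_norm_le_const (C := V t) fun s hs => ?_).trans ?_
    · rw [Set.uIoc_of_le hx0] at hs
      rw [Real.norm_of_nonneg (h.nonneg _)]
      exact h.mono (by linarith [hs.2])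
    · rw [sub_zero, abs_of_nonneg hx0]
      exact mul_le_mul_of_nonneg_left (by linarith) (h.nonneg t)

theorem integrable_sq_shift [IsProbabilityMeasure F] (h : IsRenewal F G V) {t : ℝ} (ht : 0 ≤ t) :
    Integrable (fun x => (max (t - x) 0) ^ 2) F := by
  refine Integrable.of_bound
    (by fun_prop : Continuous fun x => (max (t - x) 0) ^ 2).aestronglyMeasurable (t ^ 2) ?_
  filter_upwards [h.step_pos] with x hx
  rw [Real.norm_of_nonneg (by positivity)]
  gcongr
  exact max_le (by linarith) ht

theorem integrable_integral_excess_shift [IsProbabilityMeasure F] (h : IsRenewal F G V) {t : ℝ}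
    (ht : 0 ≤ t) : Integrable (fun x => ∫ s in (0 : ℝ)..(t - x), excess F V s) F := by
  simp only [h.integral_excess]
  exact (h.integrable_integral_shift ht).sub ((h.integrable_sq_shift ht).div_const _)

theorem integrable_delay_shift [IsProbabilityMeasure G] (h : IsRenewal F G V) (t : ℝ) :
    Integrable (fun y => max (t - y) 0) G :=
  ((integrable_const t).sub h.delay_int).pos_part

/-- The inserted terms -t and 2tx cancel after integration, since 2tm/(2m) = t. They are there to
make the integrands dominated by y and x², uniformly in t ≥ 0. -/
theorem integral_excess_renewal [IsProbabilityMeasure F] [IsProbabilityMeasure G]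
    (h : IsRenewal F G V) {t : ℝ} (ht : 0 ≤ t) :
    (∫ s in (0 : ℝ)..t, excess F V s) - ∫ x, (∫ s in (0 : ℝ)..(t - x), excess F V s) ∂F =
      ∫ y, (max (t - y) 0 - t) ∂G +
        (∫ x, ((max (t - x) 0) ^ 2 - t ^ 2 + 2 * t * x) ∂F) / (2 * ∫ x, x ∂F) := by
  have hm := h.mean_pos
  simp only [h.integral_excess]
  rw [h.integral_eq ht, integral_sub (h.integrable_integral_shift ht)
    ((h.integrable_sq_shift ht).div_const _), integral_div,
    integral_sub (h.integrable_delay_shift t) (integrable_const _),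
    integral_add (f := fun x => (max (t - x) 0) ^ 2 - t ^ 2)
      ((h.integrable_sq_shift ht).sub (integrable_const _)) (h.step_int.const_mul _),
    integral_sub (h.integrable_sq_shift ht) (integrable_const _), integral_const_mul,
    max_eq_left ht]
  simp only [integral_const, probReal_univ, smul_eq_mul, one_mul]
  field_simp
  ring

theorem tendsto_integral_excess_renewal [IsProbabilityMeasure F] [IsProbabilityMeasure G]
    (h : IsRenewal F G V) :
    Tendsto (fun t => (∫ s in (0 : ℝ)..t, excess F V s) -
        ∫ x, (∫ s in (0 : ℝ)..(t - x), excess F V s) ∂F) atTop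
      (𝓝 ((∫ x, x ^ 2 ∂F) / (2 * ∫ x, x ∂F) - ∫ y, y ∂G)) := by
  have h1 : Tendsto (fun t => ∫ y, (max (t - y) 0 - t) ∂G) atTop (𝓝 (∫ y, -y ∂G)) := by
    refine tendsto_integral_filter_of_dominated_convergence (fun y => y) ?_ ?_ h.delay_int ?_
    · exact Eventually.of_forall fun t =>
        (by fun_prop : Continuous fun y => max (t - y) 0 - t).aestronglyMeasurable
    · filter_upwards [eventually_ge_atTop 0] with t ht
      filter_upwards [h.delay_pos] with y hy
      rw [Real.norm_eq_abs, abs_le]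
      exact ⟨by linarith [le_max_left (t - y) 0],
        by linarith [max_le (by linarith : t - y ≤ t) ht]⟩
    · refine Eventually.of_forall fun y => tendsto_const_nhds.congr' ?_
      filter_upwards [eventually_ge_atTop y] with t ht
      rw [max_eq_left (by linarith)]; ring
  have h2 : Tendsto (fun t => ∫ x, ((max (t - x) 0) ^ 2 - t ^ 2 + 2 * t * x) ∂F) atTop
      (𝓝 (∫ x, x ^ 2 ∂F)) := by
    refine tendsto_integral_filter_of_dominated_convergence (fun x => x ^ 2) ?_ ?_ h.step_sq ?_
    · exact Eventually.of_forall fun t =>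
        (by fun_prop : Continuous fun x => (max (t - x) 0) ^ 2 - t ^ 2 + 2 * t * x).aestronglyMeasurable
    · filter_upwards [eventually_ge_atTop 0] with t ht
      filter_upwards [h.step_pos] with x hx
      rw [Real.norm_eq_abs, abs_le]
      rcases le_total (t - x) 0 with h0 | h0
      · rw [max_eq_right h0]
        constructor <;> nlinarith
      · rw [max_eq_left h0]
        constructor <;> nlinarith
    · refine Eventually.of_forall fun x => tendsto_const_nhds.congr' ?_
      filter_upwards [eventually_ge_atTop x] with t ht
      rw [max_eq_left (by linarith)]; ring
  have h3 := h1.add (h2.div_const (2 * ∫ x, x ∂F))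
  rw [integral_neg, neg_add_eq_sub] at h3
  refine h3.congr' ?_
  filter_upwards [eventually_ge_atTop 0] with t ht
  rw [h.integral_excess_renewal ht]

/-- V is nondecreasing, so the excess can fall only through its linear part. This is the one-sided
Tauberian condition that later passes from averages to the excess itself. -/
theorem excess_increment_le [IsProbabilityMeasure F] (h : IsRenewal F G V) {s t : ℝ}
    (hst : s ≤ t) : excess F V s - (t - s) / (∫ x, x ∂F) ≤ excess F V t := by
  have hm := h.mean_pos
  unfold excess
  have h1 := h.mono hst
  have h2 : max t 0 - max s 0 ≤ t - s := by
    rcases max_cases t 0 with h | h <;> rcases max_cases s 0 with h' | h' <;> linarith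
  have h3 := div_le_div_of_nonneg_right h2 hm.le
  rw [sub_div] at h3
  linarith

theorem exists_excess_increment_le [IsProbabilityMeasure F] [IsProbabilityMeasure G]
    (h : IsRenewal F G V) :
    ∃ C : ℝ, 0 ≤ C ∧ ∀ t x, 0 ≤ x → |excess F V t - excess F V (t - x)| ≤ C * (1 + x) := by
  have hm := h.mean_pos
  obtain ⟨C, hC, hC'⟩ := h.exists_increment_le
  refine ⟨C + 1 / ∫ x, x ∂F, by positivity, fun t x hx => abs_le.2 ⟨?_, ?_⟩⟩
  · have h1 := h.excess_increment_le (s := t - x) (t := t) (by linarith)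
    rw [sub_sub_cancel, div_eq_mul_one_div] at h1
    have h2 : 0 < 1 / ∫ x, x ∂F := by positivity
    nlinarith
  · have h1 := hC' t x hx
    have h2 : max (t - x) 0 / (∫ x, x ∂F) ≤ max t 0 / ∫ x, x ∂F := by
      gcongr; linarith
    have h3 : 0 ≤ 1 / (∫ x, x ∂F) * (1 + x) := by positivity
    unfold excess
    linarith

/-- The deviation of a renewal function from its linear approximation is bounded. -/
theorem exists_abs_excess_le [IsProbabilityMeasure F] [IsProbabilityMeasure G]
    (h : IsRenewal F G V) : ∃ M : ℝ, ∀ t, |excess F V t| ≤ M := by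
  have hm := h.mean_pos
  set m := ∫ x, x ∂F with hmdef
  obtain ⟨C, hC, hC'⟩ := h.exists_excess_increment_le
  have hpt : ∀ t x, 0 ≤ x → |(∫ s in (0 : ℝ)..t, excess F V s) -
      (∫ s in (0 : ℝ)..(t - x), excess F V s) - x * excess F V t| ≤ C * (1 + x) * x := by
    intro t x hx
    rw [h.integral_excess_sub]
    have h1 : x * excess F V t = ∫ _ in (t - x)..t, excess F V t := by simp
    rw [h1, ← intervalIntegral.integral_sub (h.intervalIntegrable_excess _ _)
      intervalIntegrable_const]
    have h3 : |t - (t - x)| = x := by rw [sub_sub_cancel, abs_of_nonneg hx]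
    suffices h4 : ‖∫ s in (t - x)..t, (excess F V s - excess F V t)‖ ≤
        C * (1 + x) * |t - (t - x)| by rwa [h3] at h4
    refine intervalIntegral.norm_integral_le_of_norm_le_const fun s hs => ?_
    rw [Set.uIoc_of_le (by linarith)] at hs
    rw [norm_sub_rev, Real.norm_eq_abs]
    have h2 := hC' t (t - s) (by linarith [hs.2])
    rw [sub_sub_cancel] at h2
    exact h2.trans (by gcongr; linarith [hs.1])
  have hint : Integrable (fun x => C * (1 + x) * x) F := by
    have : (fun x => C * (1 + x) * x) = fun x => C * x + C * x ^ 2 := by ext x; ring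
    rw [this]
    exact (h.step_int.const_mul _).add (h.step_sq.const_mul _)
  set Z := fun t => (∫ s in (0 : ℝ)..t, excess F V s) -
    ∫ x, (∫ s in (0 : ℝ)..(t - x), excess F V s) ∂F with hZ
  -- Integrating `hpt` over F costs one first and one second moment of the step; Z converges, hence
  -- is bounded for large t.
  have hZm : ∀ t, 0 ≤ t → |Z t - m * excess F V t| ≤ ∫ x, C * (1 + x) * x ∂F := by
    intro t ht
    have hi := h.integrable_integral_excess_shift ht
    have h1 : Z t - m * excess F V t = ∫ x, ((∫ s in (0 : ℝ)..t, excess F V s) -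
        (∫ s in (0 : ℝ)..(t - x), excess F V s) - x * excess F V t) ∂F := by
      rw [integral_sub (f := fun x => (∫ s in (0 : ℝ)..t, excess F V s) -
        (∫ s in (0 : ℝ)..(t - x), excess F V s)) ((integrable_const _).sub hi) (h.step_int.mul_const _),
        integral_sub (integrable_const _) hi, integral_mul_const]
      simp [hZ, hmdef]
    rw [h1, ← Real.norm_eq_abs]
    refine norm_integral_le_of_norm_le hint ?_
    filter_upwards [h.step_pos] with x hx using hpt t x hx.le
  obtain ⟨B, hB⟩ := h.tendsto_integral_excess_renewal.abs.isBoundedUnder_le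
  rw [eventually_map] at hB
  obtain ⟨T, hT⟩ := eventually_atTop.1 (hB.and (eventually_ge_atTop 0))
  set A := (B + ∫ x, C * (1 + x) * x ∂F) / m with hA
  refine ⟨max A (V T + max T 0 / m), fun t => ?_⟩
  rcases le_total T t with ht | ht
  · refine le_trans ?_ (le_max_left _ _)
    rw [hA, le_div_iff₀ hm]
    have h1 := (hT t ht).1
    have h2 := hZm t (hT t ht).2
    have h3 := abs_sub_abs_le_abs_sub (m * excess F V t) (Z t)
    rw [abs_sub_comm _ (Z t), abs_mul, abs_of_pos hm] at h3
    have h1' : |Z t| ≤ B := h1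
    linarith
  · refine le_trans ?_ (le_max_right _ _)
    have h1 := h.nonneg t
    have h2 := h.mono ht
    have h3 : max t 0 / m ≤ max T 0 / m := by gcongr
    have h4 : 0 ≤ max t 0 / m := by positivity
    unfold excess
    exact abs_le.2 ⟨by linarith, by linarith⟩

end IsRenewal
end IteratedPerturbedWalk

/-! ### Slow variation and convergence of the excess -/

namespace IteratedPerturbedWalk
namespace IsRenewal

variable {F G : Measure ℝ} {V : ℝ → ℝ}

/-- Sliding averages of the excess are slowly varying. -/
theorem tendsto_average_increment [IsProbabilityMeasure F] [IsProbabilityMeasure G]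
    (h : IsRenewal F G V) (hnl : ∀ d : ℝ, 0 < d → ¬ ∀ᵐ x ∂F, ∃ n : ℕ, x = n * d)
    {δ : ℝ} (hδ : 0 < δ) (a : ℝ) :
    Tendsto (fun t => (∫ s in (t + a)..(t + a + δ), excess F V s) / δ -
      (∫ s in t..(t + δ), excess F V s) / δ) atTop (𝓝 0) := by
  obtain ⟨M, hM⟩ := h.exists_abs_excess_le
  have hM0 : 0 ≤ M := (abs_nonneg _).trans (hM 0)
  have hJ : ∀ a b, |∫ s in a..b, excess F V s| ≤ M * |b - a| := fun a b => by
    rw [← Real.norm_eq_abs]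
    exact intervalIntegral.norm_integral_le_of_norm_le_const fun s _ => hM s
  refine tendsto_increment_zero (F := F) (M := M) (K := (2 * M / δ).toNNReal)
    (g := fun t => (∫ s in t..(t + δ), excess F V s) / δ) h.step_pos hnl ?_ ?_ ?_ a
  · intro t
    rw [abs_div, abs_of_pos hδ, div_le_iff₀ hδ]
    refine (hJ _ _).trans ?_
    rw [add_sub_cancel_left, abs_of_pos hδ]
  · refine LipschitzWith.of_dist_le_mul fun s t => ?_
    rw [Real.coe_toNNReal _ (by positivity), Real.dist_eq, Real.dist_eq, ← sub_div, abs_div,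
      abs_of_pos hδ, div_le_iff₀ hδ]
    have h1 := hJ t s
    have h2 := hJ (t + δ) (s + δ)
    rw [add_sub_add_right_eq_sub] at h2
    have h3 : (∫ u in s..(s + δ), excess F V u) - (∫ u in t..(t + δ), excess F V u) =
        (∫ u in (t + δ)..(s + δ), excess F V u) - ∫ u in t..s, excess F V u := by
      rw [← h.integral_excess_sub s, ← h.integral_excess_sub t (t + δ),
        ← h.integral_excess_sub (t + δ), ← h.integral_excess_sub t s]
      ring
    rw [h3]
    refine (abs_sub _ _).trans ?_
    calc _ ≤ M * |s - t| + M * |s - t| := add_le_add h2 h1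
      _ = _ := by field_simp; ring
  -- The defect from harmonicity of the average is (Z(t+δ) - Z(t))/δ, which vanishes because Z
  -- converges.
  · have hZ := h.tendsto_integral_excess_renewal
    have h1 := ((hZ.comp (tendsto_atTop_add_const_right atTop δ tendsto_id)).sub hZ).div_const δ
    rw [sub_self, zero_div] at h1
    refine h1.congr' ?_
    filter_upwards [eventually_ge_atTop 0] with t ht
    simp only [Function.comp_def, id]
    have hd : ∀ t, ∫ s in t..(t + δ), excess F V s =
      (∫ s in (0 : ℝ)..(t + δ), excess F V s) - ∫ s in (0 : ℝ)..t, excess F V s :=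
      fun t => (h.integral_excess_sub _ _).symm
    simp only [hd]
    rw [integral_div, integral_sub]
    · simp only [sub_add_eq_add_sub]
      ring
    · simp only [sub_add_eq_add_sub]
      exact h.integrable_integral_excess_shift (by positivity)
    · exact h.integrable_integral_excess_shift ht

/-- Within distance δ to the right the excess drops by at most δ/m. The mirror bound
`average_le_excess` uses the window to the left. -/
theorem excess_le_average [IsProbabilityMeasure F] (h : IsRenewal F G V) {δ : ℝ} (hδ : 0 < δ)
    (t : ℝ) : excess F V t ≤ (∫ s in t..(t + δ), excess F V s) / δ + δ / ∫ x, x ∂F := by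
  have hm := h.mean_pos
  have h1 : ∫ _ in t..(t + δ), (excess F V t - δ / ∫ x, x ∂F) ≤ ∫ s in t..(t + δ), excess F V s := by
    refine intervalIntegral.integral_mono_on (by linarith) intervalIntegrable_const
      (h.intervalIntegrable_excess _ _) fun s hs => ?_
    refine le_trans ?_ (h.excess_increment_le hs.1)
    gcongr
    linarith [hs.2]
  rw [intervalIntegral.integral_const, add_sub_cancel_left, smul_eq_mul, mul_comm,
    ← le_div_iff₀ hδ] at h1
  linarith

theorem average_le_excess [IsProbabilityMeasure F] (h : IsRenewal F G V) {δ : ℝ} (hδ : 0 < δ)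
    (t : ℝ) : (∫ s in (t - δ)..(t - δ + δ), excess F V s) / δ ≤
      excess F V t + δ / ∫ x, x ∂F := by
  have hm := h.mean_pos
  have h1 : ∫ s in (t - δ)..(t - δ + δ), excess F V s ≤
      ∫ _ in (t - δ)..(t - δ + δ), (excess F V t + δ / ∫ x, x ∂F) := by
    refine intervalIntegral.integral_mono_on (by linarith) (h.intervalIntegrable_excess _ _)
      intervalIntegrable_const fun s hs => ?_
    have h2 := h.excess_increment_le (s := s) (t := t) (by linarith [hs.2])
    have h3 : (t - s) / (∫ x, x ∂F) ≤ δ / ∫ x, x ∂F := by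
      gcongr
      linarith [hs.1]
    linarith
  rw [intervalIntegral.integral_const, add_sub_cancel_left, smul_eq_mul] at h1
  rw [div_le_iff₀ hδ]
  linarith

theorem eventually_excess_increment_lt [IsProbabilityMeasure F] [IsProbabilityMeasure G]
    (h : IsRenewal F G V) (hnl : ∀ d : ℝ, 0 < d → ¬ ∀ᵐ x ∂F, ∃ n : ℕ, x = n * d) (a : ℝ)
    {ε : ℝ} (hε : 0 < ε) : ∀ᶠ t in atTop, excess F V (t + a) - excess F V t < ε := by
  have hm := h.mean_pos
  set m := ∫ x, x ∂F with hmdef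
  -- The two comparisons with averages lose δ/m = ε/4 each, leaving ε/2 for the increment of the
  -- average from t-δ to t+a.
  set δ := ε * m / 4 with hδdef
  have hδ : 0 < δ := by positivity
  have h1 := (h.tendsto_average_increment hnl hδ (a + δ)).comp
    (tendsto_atTop_add_const_right atTop (-δ) tendsto_id)
  filter_upwards [h1.eventually (gt_mem_nhds (half_pos hε))] with t ht
  simp only [Function.comp_def, id] at ht
  have h2 := h.excess_le_average hδ (t + a)
  have h3 := h.average_le_excess hδ t
  rw [show t + -δ + (a + δ) = t + a by ring, ← sub_eq_add_neg] at ht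
  have h4 : δ / m = ε / 4 := by rw [hδdef]; field_simp
  rw [← hmdef, h4] at h2 h3
  linarith

/-- The excess of a renewal function is slowly varying. -/
theorem tendsto_excess_increment [IsProbabilityMeasure F] [IsProbabilityMeasure G]
    (h : IsRenewal F G V) (hnl : ∀ d : ℝ, 0 < d → ¬ ∀ᵐ x ∂F, ∃ n : ℕ, x = n * d) (a : ℝ) :
    Tendsto (fun t => excess F V (t + a) - excess F V t) atTop (𝓝 0) := by
  refine tendsto_order.2 ⟨fun l hl => ?_, fun l hl => h.eventually_excess_increment_lt hnl a hl⟩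
  -- The lower bound is the upper bound for the shift -a, read at t + a.
  have h1 := (tendsto_atTop_add_const_right atTop a tendsto_id).eventually
    (h.eventually_excess_increment_lt hnl (-a) (neg_pos.2 hl))
  filter_upwards [h1] with t ht
  simp only [id, add_neg_cancel_right] at ht
  linarith

/-- Second-order renewal theorem: `V(t) - t / m` converges. -/
theorem tendsto_excess [IsProbabilityMeasure F] [IsProbabilityMeasure G]
    (h : IsRenewal F G V) (hnl : ∀ d : ℝ, 0 < d → ¬ ∀ᵐ x ∂F, ∃ n : ℕ, x = n * d) :
    Tendsto (excess F V) atTop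
      (𝓝 ((∫ x, x ∂F)⁻¹ * ((∫ x, x ^ 2 ∂F) / (2 * ∫ x, x ∂F) - ∫ y, y ∂G))) := by
  have hm := h.mean_pos
  obtain ⟨M, hM⟩ := h.exists_abs_excess_le
  have hpt : ∀ x, 0 ≤ x → Tendsto (fun t => ∫ s in (0 : ℝ)..x, (excess F V (t - s) - excess F V t))
      atTop (𝓝 0) := by
    intro x hx
    have : Tendsto (fun t => ∫ s in (0 : ℝ)..x, (excess F V (t - s) - excess F V t))
        atTop (𝓝 (∫ _ in (0 : ℝ)..x, (0 : ℝ))) := by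
      refine intervalIntegral.tendsto_integral_filter_of_dominated_convergence (fun _ => 2 * M)
        ?_ ?_ intervalIntegrable_const ?_
      · exact Eventually.of_forall fun t =>
          ((h.measurable_excess.comp (by fun_prop)).sub measurable_const).aestronglyMeasurable
      · refine Eventually.of_forall fun t => Eventually.of_forall fun s _ => ?_
        refine (norm_sub_le _ _).trans ?_
        rw [Real.norm_eq_abs, Real.norm_eq_abs]
        linarith [hM (t - s), hM t]
      · refine Eventually.of_forall fun s _ => ?_
        exact h.tendsto_excess_increment hnl (-s)
    simpa using this
  have hid : ∀ t x, (∫ s in (0 : ℝ)..t, excess F V s) - (∫ s in (0 : ℝ)..(t - x), excess F V s)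
      - x * excess F V t = ∫ s in (0 : ℝ)..x, (excess F V (t - s) - excess F V t) := by
    intro t x
    have hi : IntervalIntegrable (fun s => excess F V (t - s)) volume 0 x := by
      have h1 := (h.intervalIntegrable_excess t (t - x)).comp_sub_left t
      rwa [sub_self, sub_sub_cancel] at h1
    rw [intervalIntegral.integral_sub hi intervalIntegrable_const,
      intervalIntegral.integral_comp_sub_left, h.integral_excess_sub]
    simp
  -- This is Z(t) - m e(t) for t ≥ 0. Slow variation gives pointwise convergence in x, and
  -- boundedness of the excess gives the majorant 2Mx.
  have hbig : Tendsto (fun t => ∫ x, ((∫ s in (0 : ℝ)..t, excess F V s) -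
      (∫ s in (0 : ℝ)..(t - x), excess F V s) - x * excess F V t) ∂F) atTop
      (𝓝 (∫ _, (0 : ℝ) ∂F)) := by
    refine tendsto_integral_filter_of_dominated_convergence (fun x => 2 * M * x) ?_ ?_
      (h.step_int.const_mul _) ?_
    · refine Eventually.of_forall fun t => Continuous.aestronglyMeasurable ?_
      exact (continuous_const.sub (h.continuous_integral_excess.comp (by fun_prop))).sub
        (by fun_prop)
    · refine Eventually.of_forall fun t => ?_
      filter_upwards [h.step_pos] with x hx
      rw [hid]
      suffices h4 : ‖∫ s in (0 : ℝ)..x, (excess F V (t - s) - excess F V t)‖ ≤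
          2 * M * |x - 0| by rwa [sub_zero, abs_of_pos hx] at h4
      refine intervalIntegral.norm_integral_le_of_norm_le_const fun s _ => ?_
      refine (norm_sub_le _ _).trans ?_
      rw [Real.norm_eq_abs, Real.norm_eq_abs]
      linarith [hM (t - s), hM t]
    · filter_upwards [h.step_pos] with x hx
      simp only [hid]
      exact hpt x hx.le
  rw [integral_zero] at hbig
  have hfin := ((h.tendsto_integral_excess_renewal.sub hbig).const_mul (∫ x, x ∂F)⁻¹)
  rw [sub_zero] at hfin
  refine hfin.congr' ?_
  filter_upwards [eventually_ge_atTop 0] with t ht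
  have hi := h.integrable_integral_excess_shift ht
  rw [integral_sub (f := fun x => (∫ s in (0 : ℝ)..t, excess F V s) -
    (∫ s in (0 : ℝ)..(t - x), excess F V s)) ((integrable_const _).sub hi) (h.step_int.mul_const _),
    integral_sub (integrable_const _) hi, integral_mul_const]
  simp only [integral_const, probReal_univ, smul_eq_mul, one_mul]
  field_simp
  ring

end IsRenewal
end IteratedPerturbedWalk

/-! ### Convolution of polynomial expansions with a renewal measure -/

namespace IteratedPerturbedWalk

theorem integral_sub_pow_mul (k : ℕ) (t : ℝ) :
    ∫ s in (0 : ℝ)..t, (t - s) ^ k * s = t ^ (k + 2) / ((k + 1) * (k + 2)) := by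
  have h1 : ∫ s in (0 : ℝ)..t, (t - s) ^ k * s = ∫ s in (0 : ℝ)..t, (t * s ^ k - s ^ (k + 1)) := by
    have h2 := intervalIntegral.integral_comp_sub_left (a := 0) (b := t)
      (fun s => t * s ^ k - s ^ (k + 1)) t
    rw [sub_self, sub_zero] at h2
    rw [← h2]
    exact intervalIntegral.integral_congr fun s _ => by ring
  rw [h1, intervalIntegral.integral_sub
    ((by fun_prop : Continuous fun s : ℝ => t * s ^ k).intervalIntegrable _ _)
    ((by fun_prop : Continuous fun s : ℝ => s ^ (k + 1)).intervalIntegrable _ _),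
    intervalIntegral.integral_const_mul, integral_pow, integral_pow]
  push_cast
  simp only [ne_eq, Nat.add_eq_zero_iff, one_ne_zero, and_false, not_false_eq_true, zero_pow,
    sub_zero]
  field_simp
  ring

theorem integral_indicator_sub_pow (k : ℕ) {y t : ℝ} (hy : 0 ≤ y) (hyt : y ≤ t) :
    ∫ s in Set.Ioc 0 t, (Set.Ici y).indicator (fun s => (t - s) ^ k) s =
      (t - y) ^ (k + 1) / (k + 1) := by
  rw [setIntegral_indicator measurableSet_Ici, ← setIntegral_congr_set (s := Set.Ioc y t),
    ← intervalIntegral.integral_of_le hyt]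
  · have h2 := intervalIntegral.integral_comp_sub_left (a := y) (b := t) (fun s => s ^ k) t
    rw [h2, sub_self, integral_pow]
    simp
  · have h1 : (Set.Ioc 0 t ∩ Set.Ioi y : Set ℝ) =ᵐ[volume] (Set.Ioc 0 t ∩ Set.Ici y : Set ℝ) :=
      (ae_eq_refl _).inter Ioi_ae_eq_Ici
    have h2 : Set.Ioc y t = Set.Ioc 0 t ∩ Set.Ioi y := by
      ext s
      exact ⟨fun h => ⟨⟨hy.trans_lt h.1, h.2⟩, h.1⟩, fun h => ⟨h.2, h.1.2⟩⟩
    rwa [h2]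

section

variable {ν : Measure ℝ}

theorem isFiniteMeasure_restrict_Iic (hfin : ∀ t, ν (Set.Iic t) < ∞) (t : ℝ) :
    IsFiniteMeasure (ν.restrict (Set.Iic t)) := ⟨by simpa using hfin t⟩

theorem integrableOn_sub_pow (hfin : ∀ t, ν (Set.Iic t) < ∞) (hpos : ∀ᵐ y ∂ν, 0 ≤ y) (k : ℕ)
    (t : ℝ) : IntegrableOn (fun y => (t - y) ^ k) (Set.Iic t) ν := by
  have := isFiniteMeasure_restrict_Iic hfin t
  refine Integrable.of_bound (by fun_prop : Continuous fun y => (t - y) ^ k).aestronglyMeasurable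
    (t ^ k) ?_
  filter_upwards [ae_restrict_mem measurableSet_Iic, ae_restrict_of_ae hpos] with y hy hy0
  rw [Set.mem_Iic] at hy
  rw [norm_pow, Real.norm_of_nonneg (by linarith)]
  gcongr
  linarith

theorem integrableOn_shift (hfin : ∀ t, ν (Set.Iic t) < ∞) (hpos : ∀ᵐ y ∂ν, 0 ≤ y) {f : ℝ → ℝ}
    (hf : Monotone f) (hf0 : ∀ s, 0 ≤ f s) (t : ℝ) :
    IntegrableOn (fun y => f (t - y)) (Set.Iic t) ν := by
  have := isFiniteMeasure_restrict_Iic hfin t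
  refine Integrable.of_bound (hf.measurable.comp (by fun_prop)).aestronglyMeasurable (f t) ?_
  filter_upwards [ae_restrict_of_ae hpos] with y hy0
  rw [Real.norm_of_nonneg (hf0 _)]
  exact hf (by linarith)

/-- Repeated integration of the distribution function. -/
theorem setIntegral_sub_pow (hfin : ∀ t, ν (Set.Iic t) < ∞) (hpos : ∀ᵐ y ∂ν, 0 ≤ y) (k : ℕ)
    {t : ℝ} (ht : 0 ≤ t) :
    ∫ y in Set.Iic t, (t - y) ^ (k + 1) ∂ν =
      (k + 1) * ∫ s in (0 : ℝ)..t, (t - s) ^ k * ν.real (Set.Iic s) := by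
  have := isFiniteMeasure_restrict_Iic hfin t
  have hset : MeasurableSet {z : ℝ × ℝ | z.2 ≤ z.1} := measurableSet_le measurable_snd measurable_fst
  have hint : Integrable (Function.uncurry fun s y => (Set.Ici y).indicator (fun s => (t - s) ^ k) s)
      ((volume.restrict (Set.Ioc 0 t)).prod (ν.restrict (Set.Iic t))) := by
    have h1 : (Function.uncurry fun s y => (Set.Ici y).indicator (fun s => (t - s) ^ k) s) =
        {z : ℝ × ℝ | z.2 ≤ z.1}.indicator fun z => (t - z.1) ^ k := by
      ext z; simp [Function.uncurry, Set.indicator]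
    rw [h1]
    refine Integrable.indicator ?_ hset
    refine Integrable.of_bound
      (by fun_prop : Continuous fun z : ℝ × ℝ => (t - z.1) ^ k).aestronglyMeasurable (t ^ k) ?_
    filter_upwards [Measure.quasiMeasurePreserving_fst.ae (ae_restrict_mem measurableSet_Ioc)]
      with z hz
    rw [norm_pow, Real.norm_of_nonneg (by linarith [hz.2])]
    gcongr
    · linarith [hz.2]
    · linarith [hz.1]
  rw [intervalIntegral.integral_of_le ht]
  -- The weighted distribution function becomes a double integral over y ≤ s ≤ t; integrating over s
  -- first gives (t-y)^(k+1)/(k+1).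
  have h2 : ∀ s ∈ Set.Ioc 0 t, (t - s) ^ k * ν.real (Set.Iic s) =
      ∫ y in Set.Iic t, (Set.Ici y).indicator (fun s => (t - s) ^ k) s ∂ν := by
    intro s hs
    have h3 : (fun y => (Set.Ici y).indicator (fun s => (t - s) ^ k) s) =
        (Set.Iic s).indicator fun _ => (t - s) ^ k := by
      ext z; simp [Set.indicator]
    rw [h3, integral_indicator measurableSet_Iic, setIntegral_const,
      measureReal_restrict_apply measurableSet_Iic,
      Set.inter_eq_left.2 (Set.Iic_subset_Iic.2 hs.2), smul_eq_mul, mul_comm]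
  rw [setIntegral_congr_fun measurableSet_Ioc h2, integral_integral_swap hint,
    ← integral_const_mul]
  refine integral_congr_ae ?_
  filter_upwards [ae_restrict_mem measurableSet_Iic, ae_restrict_of_ae hpos] with y hy hy0
  rw [integral_indicator_sub_pow k hy0 hy]
  field_simp

end

namespace IsRenewal

variable {F G : Measure ℝ} {V : ℝ → ℝ} {ν : Measure ℝ}

theorem tendsto_setIntegral_sub_pow [IsProbabilityMeasure F] [IsProbabilityMeasure G]
    (h : IsRenewal F G V) (hfin : ∀ t, ν (Set.Iic t) < ∞) (hpos : ∀ᵐ y ∂ν, 0 ≤ y)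
    (hV : ∀ t, V t = ν.real (Set.Iic t)) {b : ℝ} (hb : Tendsto (excess F V) atTop (𝓝 b)) (k : ℕ) :
    Tendsto (fun t => ((∫ y in Set.Iic t, (t - y) ^ k ∂ν) -
      t ^ (k + 1) / ((k + 1) * ∫ x, x ∂F)) / t ^ k) atTop (𝓝 b) := by
  have hm := h.mean_pos
  rcases k with _ | k
  · refine hb.congr' ?_
    filter_upwards [eventually_ge_atTop 0] with t ht
    simp [excess, hV, max_eq_left ht]
  obtain ⟨M, hM⟩ := h.exists_abs_excess_le
  -- After the substitution s = tu, the excess at tu tends to b for each u > 0, under the constant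
  -- majorant M.
  have hlim : Tendsto (fun t => ∫ u in (0 : ℝ)..1, (1 - u) ^ k * excess F V (t * u)) atTop
      (𝓝 (∫ u in (0 : ℝ)..1, (1 - u) ^ k * b)) := by
    refine intervalIntegral.tendsto_integral_filter_of_dominated_convergence (fun _ => M) ?_ ?_
      intervalIntegrable_const ?_
    · exact Eventually.of_forall fun t => ((by fun_prop : Measurable fun u : ℝ => (1 - u) ^ k).mul
        (h.measurable_excess.comp (by fun_prop))).aestronglyMeasurable
    · refine Eventually.of_forall fun t => Eventually.of_forall fun u hu => ?_
      rw [Set.uIoc_of_le zero_le_one] at hu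
      rw [norm_mul, norm_pow, Real.norm_of_nonneg (by linarith [hu.2])]
      have h1 : (1 - u) ^ k ≤ 1 := pow_le_one₀ (by linarith [hu.2]) (by linarith [hu.1])
      calc _ ≤ 1 * ‖excess F V (t * u)‖ := by gcongr
        _ ≤ M := by rw [one_mul]; exact hM _
    · refine Eventually.of_forall fun u hu => ?_
      rw [Set.uIoc_of_le zero_le_one] at hu
      exact (hb.comp (tendsto_id.atTop_mul_const hu.1)).const_mul _
  have hval : ∫ u in (0 : ℝ)..1, (1 - u) ^ k * b = b / (k + 1) := by
    rw [intervalIntegral.integral_mul_const, intervalIntegral.integral_comp_sub_left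
      (fun u => u ^ k), integral_pow]
    simp
    ring
  rw [hval] at hlim
  have hfinal := hlim.const_mul ((k : ℝ) + 1)
  rw [mul_div_cancel₀ b (by positivity)] at hfinal
  refine hfinal.congr' ?_
  filter_upwards [eventually_gt_atTop 0] with t ht
  rw [setIntegral_sub_pow hfin hpos k ht.le]
  have hsplit : ∫ s in (0 : ℝ)..t, (t - s) ^ k * ν.real (Set.Iic s) =
      (∫ s in (0 : ℝ)..t, (t - s) ^ k * s) / (∫ x, x ∂F) +
        ∫ s in (0 : ℝ)..t, (t - s) ^ k * excess F V s := by
    rw [← intervalIntegral.integral_div, ← intervalIntegral.integral_add]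
    · refine intervalIntegral.integral_congr fun s hs => ?_
      rw [Set.uIcc_of_le ht.le] at hs
      simp only [excess, ← hV, max_eq_left hs.1]
      ring
    · exact (by fun_prop : Continuous fun s => (t - s) ^ k * s / ∫ x, x ∂F).intervalIntegrable _ _
    · exact (h.intervalIntegrable_excess 0 t).continuousOn_mul
        (by fun_prop : Continuous fun s => (t - s) ^ k).continuousOn
  have hscale : ∫ s in (0 : ℝ)..t, (t - s) ^ k * excess F V s =
      t ^ (k + 1) * ∫ u in (0 : ℝ)..1, (1 - u) ^ k * excess F V (t * u) := by
    have h1 := intervalIntegral.mul_integral_comp_mul_left (a := 0) (b := 1)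
      (f := fun s => (t - s) ^ k * excess F V s) (c := t)
    rw [mul_zero, mul_one] at h1
    rw [← h1, pow_succ' t, mul_assoc, ← intervalIntegral.integral_const_mul (t ^ k)]
    congr 1
    refine intervalIntegral.integral_congr fun u _ => ?_
    rw [← mul_assoc, ← mul_pow, mul_sub, mul_one]
  rw [hsplit, hscale, integral_sub_pow_mul]
  generalize ∫ u in (0 : ℝ)..1, (1 - u) ^ k * excess F V (t * u) = I
  push_cast
  field_simp
  ring

theorem tendsto_setIntegral_sub_pow_div [IsProbabilityMeasure F] [IsProbabilityMeasure G]
    (h : IsRenewal F G V) (hfin : ∀ t, ν (Set.Iic t) < ∞) (hpos : ∀ᵐ y ∂ν, 0 ≤ y)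
    (hV : ∀ t, V t = ν.real (Set.Iic t)) {b : ℝ} (hb : Tendsto (excess F V) atTop (𝓝 b)) (k : ℕ) :
    Tendsto (fun t => (∫ y in Set.Iic t, (t - y) ^ k ∂ν) / t ^ (k + 1)) atTop
      (𝓝 (1 / ((k + 1) * ∫ x, x ∂F))) := by
  have hm := h.mean_pos
  have h1 := ((h.tendsto_setIntegral_sub_pow hfin hpos hV hb k).mul tendsto_inv_atTop_zero).add_const
    (1 / ((k + 1) * ∫ x, x ∂F))
  rw [mul_zero, zero_add] at h1
  refine h1.congr' ?_
  filter_upwards [eventually_gt_atTop 0] with t ht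
  field_simp
  ring

/-- Convolution with a renewal measure of a function with a two-term expansion. -/
theorem tendsto_conv [IsProbabilityMeasure F] [IsProbabilityMeasure G]
    (h : IsRenewal F G V) (hfin : ∀ t, ν (Set.Iic t) < ∞) (hpos : ∀ᵐ y ∂ν, 0 ≤ y)
    (hV : ∀ t, V t = ν.real (Set.Iic t)) {b : ℝ} (hb : Tendsto (excess F V) atTop (𝓝 b)) (k : ℕ)
    {f : ℝ → ℝ} (hf : Monotone f) (hf0 : ∀ s, 0 ≤ f s) {α c : ℝ}
    (hfc : Tendsto (fun s => (f s - α * s ^ (k + 1)) / s ^ k) atTop (𝓝 c)) :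
    Tendsto (fun t => ((∫ y in Set.Iic t, f (t - y) ∂ν) -
        α * t ^ (k + 2) / ((k + 2) * ∫ x, x ∂F)) / t ^ (k + 1)) atTop
      (𝓝 (α * b + c / ((k + 1) * ∫ x, x ∂F))) := by
  have hm := h.mean_pos
  set m := ∫ x, x ∂F with hmdef
  set A : ℕ → ℝ → ℝ := fun k t => ∫ y in Set.Iic t, (t - y) ^ k ∂ν with hA
  have hA1 : Tendsto (fun t => (A (k + 1) t - t ^ (k + 2) / ((k + 2) * m)) / t ^ (k + 1)) atTop
      (𝓝 b) := by
    have h1 := h.tendsto_setIntegral_sub_pow hfin hpos hV hb (k + 1)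
    push_cast at h1
    simpa only [add_assoc, one_add_one_eq_two] using h1
  have hA2 := h.tendsto_setIntegral_sub_pow_div hfin hpos hV hb k
  -- The remainder f(s) - αs^(k+1) - cs^k is small relative to s^k only for s ≥ s₀. For s < s₀ it is
  -- merely bounded, but those s correspond to y in (t-s₀, t], whose ν-mass is bounded uniformly in
  -- t.
  have herr : Tendsto (fun t => (∫ y in Set.Iic t,
      (f (t - y) - α * (t - y) ^ (k + 1) - c * (t - y) ^ k) ∂ν) / t ^ (k + 1)) atTop (𝓝 0) := by
    obtain ⟨C, hC, hC'⟩ := h.exists_increment_le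
    rw [Metric.tendsto_atTop]
    intro η hη
    set κ := 1 / ((k + 1) * m) with hκ
    have hκ0 : 0 < κ := by positivity
    -- κ is the limit of A_k(t)/t^(k+1), eventually below κ + 1, so the tail part contributes less
    -- than η/2.
    set ε := η / (2 * (κ + 1)) with hε
    have hε0 : 0 < ε := by positivity
    obtain ⟨s₀, hs₀⟩ := eventually_atTop.1
      ((Metric.tendsto_nhds.1 hfc ε hε0).and (eventually_gt_atTop 0))
    have hs₀pos : 0 < s₀ := (hs₀ s₀ le_rfl).2
    set B := f s₀ + |α| * s₀ ^ (k + 1) + |c| * s₀ ^ k with hB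
    have hB0 : 0 ≤ B := by have := hf0 s₀; positivity
    have hρ : ∀ s, 0 ≤ s → |f s - α * s ^ (k + 1) - c * s ^ k| ≤
        ε * s ^ k + (Set.Iio s₀).indicator (fun _ => B) s := by
      intro s hs
      by_cases hss : s < s₀
      · rw [Set.indicator_of_mem (Set.mem_Iio.2 hss)]
        have h1 : |f s| ≤ f s₀ := by rw [abs_of_nonneg (hf0 s)]; exact hf hss.le
        have h2 : |α * s ^ (k + 1)| ≤ |α| * s₀ ^ (k + 1) := by
          rw [abs_mul, abs_of_nonneg (pow_nonneg hs _)]; gcongr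
        have h3 : |c * s ^ k| ≤ |c| * s₀ ^ k := by
          rw [abs_mul, abs_of_nonneg (pow_nonneg hs _)]; gcongr
        have h4 := abs_sub (f s - α * s ^ (k + 1)) (c * s ^ k)
        have h5 := abs_sub (f s) (α * s ^ (k + 1))
        have h6 : 0 ≤ ε * s ^ k := by positivity
        linarith
      · rw [Set.indicator_of_notMem (by simpa using hss), add_zero]
        obtain ⟨h1, h2⟩ := hs₀ s (not_lt.1 hss)
        have h3 : 0 < s ^ k := by positivity
        have h4 : f s - α * s ^ (k + 1) - c * s ^ k =
            ((f s - α * s ^ (k + 1)) / s ^ k - c) * s ^ k := by field_simp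
        rw [h4, abs_mul, abs_of_pos h3]
        rw [Real.dist_eq] at h1
        gcongr
    have hbound : ∀ t, 0 ≤ t → |∫ y in Set.Iic t,
        (f (t - y) - α * (t - y) ^ (k + 1) - c * (t - y) ^ k) ∂ν| ≤
        ε * A k t + B * (C * (1 + s₀)) := by
      intro t ht
      have := isFiniteMeasure_restrict_Iic hfin t
      have hsetm : MeasurableSet (Set.Ioi (t - s₀)) := measurableSet_Ioi
      have hi1 : IntegrableOn (fun y => ε * (t - y) ^ k) (Set.Iic t) ν :=
        (integrableOn_sub_pow hfin hpos k t).const_mul ε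
      have hi2 : IntegrableOn ((Set.Ioi (t - s₀)).indicator fun _ => B) (Set.Iic t) ν :=
        (integrable_const B).indicator hsetm
      have h1 : |∫ y in Set.Iic t, (f (t - y) - α * (t - y) ^ (k + 1) - c * (t - y) ^ k) ∂ν| ≤
          ∫ y in Set.Iic t, (ε * (t - y) ^ k + (Set.Ioi (t - s₀)).indicator (fun _ => B) y) ∂ν := by
        rw [← Real.norm_eq_abs]
        refine norm_integral_le_of_norm_le (hi1.add hi2) ?_
        filter_upwards [ae_restrict_mem measurableSet_Iic] with y hy
        have h2 := hρ (t - y) (sub_nonneg.2 hy)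
        have h3 : (Set.Iio s₀).indicator (fun _ => B) (t - y) =
            (Set.Ioi (t - s₀)).indicator (fun _ => B) y := by
          simp only [Set.indicator, Set.mem_Iio, Set.mem_Ioi, sub_lt_comm]
        rwa [h3] at h2
      rw [integral_add hi1 hi2, integral_const_mul, integral_indicator hsetm, setIntegral_const,
        measureReal_restrict_apply hsetm, smul_eq_mul, mul_comm _ B] at h1
      refine h1.trans ?_
      gcongr
      refine le_trans (le_of_eq ?_) (hC' t s₀ hs₀pos.le)
      rw [hV, hV, ← measureReal_sdiff (Set.Iic_subset_Iic.2 (by linarith)) measurableSet_Iic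
        (hfin _).ne]
      congr 1
      ext y
      simp [and_comm]
    have h1 : ∀ᶠ t in atTop, A k t / t ^ (k + 1) < κ + 1 :=
      hA2.eventually (gt_mem_nhds (by linarith))
    have h2 : Tendsto (fun t : ℝ => B * (C * (1 + s₀)) / t ^ (k + 1)) atTop (𝓝 0) :=
      tendsto_const_nhds.div_atTop (tendsto_pow_atTop (by omega))
    have hev : ∀ᶠ t in atTop, dist ((∫ y in Set.Iic t,
      (f (t - y) - α * (t - y) ^ (k + 1) - c * (t - y) ^ k) ∂ν) / t ^ (k + 1)) 0 < η := by
      filter_upwards [h1, h2.eventually (gt_mem_nhds (half_pos hη)), eventually_gt_atTop 0]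
        with t ht1 ht2 ht0
      rw [Real.dist_eq, sub_zero, abs_div, abs_of_pos (pow_pos ht0 _)]
      calc _ ≤ (ε * A k t + B * (C * (1 + s₀))) / t ^ (k + 1) := by
            gcongr; exact hbound t ht0.le
        _ = ε * (A k t / t ^ (k + 1)) + B * (C * (1 + s₀)) / t ^ (k + 1) := by ring
        _ < ε * (κ + 1) + η / 2 := by gcongr
        _ = η := by rw [hε]; field_simp; ring
    exact eventually_atTop.1 hev
  have hsum := ((hA1.const_mul α).add (hA2.const_mul c)).add herr
  rw [add_zero, mul_one_div] at hsum
  refine hsum.congr fun t => ?_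
  have hi1 := integrableOn_shift hfin hpos hf hf0 t
  have hi2 := (integrableOn_sub_pow hfin hpos (k + 1) t).const_mul α
  have hi3 := (integrableOn_sub_pow hfin hpos k t).const_mul c
  rw [integral_sub (f := fun y => f (t - y) - α * (t - y) ^ (k + 1)) (hi1.sub hi2) hi3,
    integral_sub hi1 hi2, integral_const_mul, integral_const_mul]
  ring

end IsRenewal
end IteratedPerturbedWalk

/-! ### Convolution powers and the intensity measure -/

noncomputable section

namespace IteratedPerturbedWalk

theorem sum_conv_sum {ι κ : Type*} [Countable ι] [Countable κ] (σ : ι → Measure ℝ)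
    (τ : κ → Measure ℝ) [∀ i, SFinite (τ i)] :
    Measure.sum σ ∗ Measure.sum τ = Measure.sum fun p : ι × κ => σ p.1 ∗ τ p.2 := by
  unfold Measure.conv
  rw [Measure.prod_sum, Measure.map_sum (by fun_prop)]

theorem conv_sum {κ : Type*} [Countable κ] (σ : Measure ℝ)
    (τ : κ → Measure ℝ) [∀ i, SFinite (τ i)] :
    σ ∗ Measure.sum τ = Measure.sum fun i => σ ∗ τ i := by
  unfold Measure.conv
  rw [Measure.prod_sum_right, Measure.map_sum (by fun_prop)]

theorem conv_Iic (σ τ : Measure ℝ) [SFinite τ] (t : ℝ) :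
    (σ ∗ τ) (Set.Iic t) = ∫⁻ x, τ (Set.Iic (t - x)) ∂σ := by
  rw [← lintegral_indicator_one measurableSet_Iic, Measure.lintegral_conv
    (measurable_one.indicator measurableSet_Iic)]
  refine lintegral_congr fun x => ?_
  rw [← lintegral_indicator_one measurableSet_Iic]
  refine lintegral_congr fun y => ?_
  simp only [Set.indicator, Set.mem_Iic, le_sub_iff_add_le', Pi.one_apply]

theorem ae_nonneg_conv {σ τ : Measure ℝ} [SFinite σ] [SFinite τ] (hσ : ∀ᵐ x ∂σ, 0 ≤ x)
    (hτ : ∀ᵐ x ∂τ, 0 ≤ x) : ∀ᵐ x ∂(σ ∗ τ), 0 ≤ x := by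
  unfold Measure.conv
  rw [ae_map_iff (by fun_prop) measurableSet_Ici]
  filter_upwards [Measure.quasiMeasurePreserving_fst.ae hσ,
    Measure.quasiMeasurePreserving_snd.ae hτ] with z h1 h2
  exact add_nonneg h1 h2

/-- The Laplace transform of a measure at `1`. -/
def laplaceOne (σ : Measure ℝ) : ℝ≥0∞ := ∫⁻ x, ENNReal.ofReal (Real.exp (-x)) ∂σ

theorem laplaceOne_conv (σ τ : Measure ℝ) [SFinite τ] :
    laplaceOne (σ ∗ τ) = laplaceOne σ * laplaceOne τ := by
  unfold laplaceOne
  rw [Measure.lintegral_conv (by fun_prop)]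
  simp_rw [neg_add, Real.exp_add, ENNReal.ofReal_mul (Real.exp_pos _).le]
  rw [← lintegral_mul_const _ (by fun_prop)]
  refine lintegral_congr fun x => ?_
  rw [lintegral_const_mul _ (by fun_prop)]

theorem laplaceOne_dirac_zero : laplaceOne (Measure.dirac 0) = 1 := by
  simp [laplaceOne]

/-- Markov's inequality: exp(-x) is at least exp(-t) on the half-line up to t. -/
theorem measure_Iic_lt_top {σ : Measure ℝ} (h : laplaceOne σ < ∞) (t : ℝ) :
    σ (Set.Iic t) < ∞ := by
  have h1 := mul_meas_ge_le_lintegral (μ := σ)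
    (by fun_prop : Measurable fun x => ENNReal.ofReal (Real.exp (-x)))
    (ENNReal.ofReal (Real.exp (-t)))
  have h2 : {x | ENNReal.ofReal (Real.exp (-t)) ≤ ENNReal.ofReal (Real.exp (-x))} = Set.Iic t := by
    ext x
    simp [ENNReal.ofReal_le_ofReal_iff (Real.exp_pos _).le]
  rw [h2] at h1
  refine lt_of_mul_lt_mul_left' (a := ENNReal.ofReal (Real.exp (-t))) ?_
  refine (h1.trans_lt h).trans_le ?_
  rw [ENNReal.mul_top (by simp [Real.exp_pos])]

theorem laplaceOne_lt_one {σ : Measure ℝ} [IsProbabilityMeasure σ] (hσ : ∀ᵐ x ∂σ, 0 < x) :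
    laplaceOne σ < 1 := by
  have h1 : ∀ᵐ x ∂σ, ENNReal.ofReal (Real.exp (-x)) < 1 := by
    filter_upwards [hσ] with x hx
    rw [ENNReal.ofReal_lt_one, Real.exp_lt_one_iff]
    linarith
  have h2 : ∫⁻ x, ENNReal.ofReal (Real.exp (-x)) ∂σ ≤ ∫⁻ _, 1 ∂σ :=
    lintegral_mono_ae (h1.mono fun x hx => hx.le)
  have h3 := lintegral_strict_mono (μ := σ) (IsProbabilityMeasure.ne_zero σ) (g := fun _ => 1)
    aemeasurable_const (h2.trans_lt (by simp)).ne h1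
  simpa [laplaceOne] using h3

/-- Convolution powers of a measure. -/
def convPow (σ : Measure ℝ) : ℕ → Measure ℝ
  | 0 => Measure.dirac 0
  | i + 1 => σ ∗ convPow σ i

instance (σ : Measure ℝ) [SFinite σ] (i : ℕ) : SFinite (convPow σ i) := by
  induction i with
  | zero => unfold convPow; infer_instance
  | succ i ih => unfold convPow; infer_instance

theorem laplaceOne_convPow (σ : Measure ℝ) [SFinite σ] (i : ℕ) :
    laplaceOne (convPow σ i) = laplaceOne σ ^ i := by
  induction i with
  | zero => rw [convPow, laplaceOne_dirac_zero, pow_zero]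
  | succ i ih => rw [convPow, laplaceOne_conv, ih, pow_succ']

theorem ae_nonneg_convPow {σ : Measure ℝ} [SFinite σ] (hσ : ∀ᵐ x ∂σ, 0 ≤ x) (i : ℕ) :
    ∀ᵐ x ∂(convPow σ i), 0 ≤ x := by
  induction i with
  | zero =>
    rw [convPow, ae_dirac_iff measurableSet_Ici]
  | succ i ih => exact ae_nonneg_conv hσ ih

/-- The law of the `i`th point of the perturbed random walk. -/
def pointLaw (F G : Measure ℝ) (i : ℕ) : Measure ℝ := convPow F i ∗ G

instance (F G : Measure ℝ) [SFinite F] [SFinite G] (i : ℕ) : SFinite (pointLaw F G i) := by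
  unfold pointLaw; infer_instance

/-- The intensity measure of the perturbed random walk. -/
def intensity (F G : Measure ℝ) : Measure ℝ := Measure.sum (pointLaw F G)

instance (F G : Measure ℝ) [SFinite F] [SFinite G] : SFinite (intensity F G) := by
  unfold intensity; infer_instance

/-- The first point contributes G; in every later one a factor F splits off, leaving the preceding
point's law. -/
theorem intensity_eq (F G : Measure ℝ) [SFinite F] [SFinite G] :
    intensity F G = G + F ∗ intensity F G := by
  unfold intensity
  rw [conv_sum]
  ext s hs
  rw [Measure.add_apply, Measure.sum_apply _ hs, Measure.sum_apply _ hs,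
    tsum_eq_zero_add' ENNReal.summable]
  congr 2
  · simp [pointLaw, convPow]
  · ext i
    rw [pointLaw, convPow, pointLaw, Measure.conv_assoc]

theorem ae_nonneg_intensity {F G : Measure ℝ} [SFinite F] [SFinite G] (hF : ∀ᵐ x ∂F, 0 ≤ x)
    (hG : ∀ᵐ x ∂G, 0 ≤ x) : ∀ᵐ x ∂(intensity F G), 0 ≤ x :=
  Measure.ae_sum_iff.2 fun i => ae_nonneg_conv (ae_nonneg_convPow hF i) hG

/-- The transforms of the point laws form a geometric series whose ratio, the transform of F, is
below 1 because the steps are positive. -/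
theorem laplaceOne_intensity_lt_top {F G : Measure ℝ} [IsProbabilityMeasure F]
    [IsProbabilityMeasure G] (hF : ∀ᵐ x ∂F, 0 < x) (hG : ∀ᵐ x ∂G, 0 < x) :
    laplaceOne (intensity F G) < ∞ := by
  have h1 : laplaceOne (intensity F G) = (1 - laplaceOne F)⁻¹ * laplaceOne G := by
    rw [laplaceOne, intensity, lintegral_sum_measure, ← ENNReal.tsum_geometric,
      ← ENNReal.tsum_mul_right]
    refine tsum_congr fun i => ?_
    rw [← laplaceOne_convPow, ← laplaceOne_conv, pointLaw, laplaceOne]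
  rw [h1]
  refine ENNReal.mul_lt_top (ENNReal.inv_lt_top.2 (tsub_pos_of_lt (laplaceOne_lt_one hF)))
    ((laplaceOne_lt_one hG).trans ENNReal.one_lt_top)

theorem laplaceOne_convPow_intensity_lt_top {F G : Measure ℝ} [IsProbabilityMeasure F]
    [IsProbabilityMeasure G] (hF : ∀ᵐ x ∂F, 0 < x) (hG : ∀ᵐ x ∂G, 0 < x) (j : ℕ) :
    laplaceOne (convPow (intensity F G) j) < ∞ := by
  rw [laplaceOne_convPow]
  exact ENNReal.pow_lt_top (laplaceOne_intensity_lt_top hF hG)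

theorem measurable_measure_Iic_sub (σ : Measure ℝ) (t : ℝ) :
    Measurable fun x : ℝ => σ (Set.Iic (t - x)) := by
  have : Antitone fun x : ℝ => σ (Set.Iic (t - x)) := fun x y hxy =>
    measure_mono (Set.Iic_subset_Iic.2 (by linarith))
  exact this.measurable

theorem measure_Iic_of_neg {σ : Measure ℝ} (hσ : ∀ᵐ x ∂σ, 0 ≤ x) {t : ℝ} (ht : t < 0) :
    σ (Set.Iic t) = 0 := by
  rw [measure_eq_zero_iff_ae_notMem]
  filter_upwards [hσ] with x hx
  simp only [Set.mem_Iic, not_le]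
  linarith

theorem isRenewal_intensity {F G : Measure ℝ} [IsProbabilityMeasure F]
    [IsProbabilityMeasure G] (hF : ∀ᵐ x ∂F, 0 < x) (hG : ∀ᵐ x ∂G, 0 < x)
    (hF2 : Integrable (fun x : ℝ => x ^ 2) F) (hG1 : Integrable (fun x : ℝ => x) G) :
    IsRenewal F G fun t => (intensity F G).real (Set.Iic t) where
  step_pos := hF
  step_sq := hF2
  delay_pos := hG
  delay_int := hG1
  mono s t hst := measureReal_mono (Set.Iic_subset_Iic.2 hst)
    (measure_Iic_lt_top (laplaceOne_intensity_lt_top hF hG) t).ne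
  zero t ht := by
    rw [measureReal_def, measure_Iic_of_neg (ae_nonneg_intensity (hF.mono fun x hx => hx.le)
      (hG.mono fun x hx => hx.le)) ht, ENNReal.toReal_zero]
  eq t := by
    have hlt := measure_Iic_lt_top (laplaceOne_intensity_lt_top hF hG)
    have h1 : intensity F G (Set.Iic t) =
        G (Set.Iic t) + ∫⁻ x, intensity F G (Set.Iic (t - x)) ∂F := by
      conv_lhs => rw [intensity_eq, Measure.add_apply, conv_Iic]
    have h2 : ∫⁻ x, intensity F G (Set.Iic (t - x)) ∂F < ∞ :=
      (le_add_self.trans h1.ge).trans_lt (hlt t)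
    simp only [measureReal_def]
    rw [integral_toReal (measurable_measure_Iic_sub _ t).aemeasurable
      (Eventually.of_forall fun x => hlt _), h1, ENNReal.toReal_add (measure_ne_top _ _) h2.ne]

theorem conv_real_Iic {σ τ : Measure ℝ} [SFinite σ] [SFinite τ] (hτ : ∀ᵐ x ∂τ, 0 ≤ x)
    (hlt : ∀ t, τ (Set.Iic t) < ∞) (t : ℝ) :
    (σ ∗ τ).real (Set.Iic t) = ∫ y in Set.Iic t, τ.real (Set.Iic (t - y)) ∂σ := by
  simp only [measureReal_def]
  rw [conv_Iic, integral_toReal (measurable_measure_Iic_sub _ t).aemeasurable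
    (Eventually.of_forall fun x => hlt _), ← lintegral_indicator measurableSet_Iic]
  congr 1
  refine lintegral_congr fun y => ?_
  by_cases hy : y ∈ Set.Iic t
  · rw [Set.indicator_of_mem hy]
  · rw [Set.indicator_of_notMem hy]
    exact measure_Iic_of_neg hτ (by simpa using hy)

/-- The law of the birth time of the individual `u` when the `i`th point has law `τ i`. -/
def wordLaw (τ : ℕ → Measure ℝ) : List ℕ → Measure ℝ
  | [] => Measure.dirac 0
  | i :: u => τ i ∗ wordLaw τ u

instance (τ : ℕ → Measure ℝ) [∀ i, SFinite (τ i)] (u : List ℕ) : SFinite (wordLaw τ u) := by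
  induction u with
  | nil => unfold wordLaw; infer_instance
  | cons i u ih => unfold wordLaw; infer_instance

/-- Splitting the first letter off words of positive length. -/
def consEquiv (j : ℕ) : ℕ × {u : List ℕ // u.length = j} ≃ {u : List ℕ // u.length = j + 1} where
  toFun p := ⟨p.1 :: p.2.1, by simp [p.2.2]⟩
  invFun u := (u.1.head (List.ne_nil_of_length_eq_add_one u.2), ⟨u.1.tail, by simp [u.2]⟩)
  left_inv p := by simp
  right_inv u := by simp

/-- Convolution distributes over countable sums, so expanding the j-th power gives one term per word
of length j. -/
theorem sum_wordLaw (τ : ℕ → Measure ℝ) [∀ i, SFinite (τ i)] (j : ℕ) :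
    Measure.sum (fun u : {u : List ℕ // u.length = j} => wordLaw τ u.1) =
      convPow (Measure.sum τ) j := by
  induction j with
  | zero =>
    ext s hs
    rw [Measure.sum_apply _ hs, tsum_eq_single ⟨[], rfl⟩]
    · rfl
    · rintro ⟨u, hu⟩ hne
      exact absurd (Subtype.ext (List.length_eq_zero_iff.1 hu)) hne
  | succ j ih =>
    rw [convPow, ← ih, sum_conv_sum]
    ext s hs
    rw [Measure.sum_apply _ hs, Measure.sum_apply _ hs, ← (consEquiv j).tsum_eq]
    rfl

end IteratedPerturbedWalk
end

/-! ### Laws of birth times and mean generation sizes -/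

namespace IteratedPerturbedWalk

section Birth

variable {Ω : Type*}

/-- Only the reproduction processes of proper ancestors, which are shorter words, enter the birth
time of u. This is what makes it independent of `X u`. -/
theorem measurable_birthTime_iSup (X : List ℕ → Ω → ℕ → ℝ) (u : List ℕ) :
    Measurable[⨆ v ∈ {v : List ℕ | v.length < u.length},
      MeasurableSpace.comap (X v) MeasurableSpace.pi] (birthTime X u) := by
  induction u with
  | nil => exact measurable_const
  | cons i u ih =>
    refine Measurable.add ?_ ?_
    · refine ih.mono ?_ le_rfl
      exact biSup_mono fun v hv => by
        simp only [Set.mem_ofPred_eq, List.length_cons] at hv ⊢; omega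
    · refine (measurable_pi_apply i).comp ?_
      refine Measurable.mono (comap_measurable (X u)) ?_ le_rfl
      exact le_iSup₂_of_le u (by simp) le_rfl

variable [MeasurableSpace Ω] {μ : Measure Ω}

theorem birthTime_congr {X Y : List ℕ → Ω → ℕ → ℝ} (h : ∀ u, X u =ᵐ[μ] Y u) (u : List ℕ) :
    birthTime X u =ᵐ[μ] birthTime Y u := by
  induction u with
  | nil => exact Eventually.of_forall fun _ => rfl
  | cons i u ih =>
    filter_upwards [ih, h u] with ω h1 h2
    simp only [birthTime, h1, h2]

theorem indepFun_birthTime {X : List ℕ → Ω → ℕ → ℝ} (hm : ∀ u, Measurable (X u))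
    (hX : iIndepFun X μ) (u : List ℕ) (i : ℕ) :
    IndepFun (fun ω => X u ω i) (birthTime X u) μ := by
  have h1 := indep_iSup_of_disjoint (fun v => (hm v).comap_le) hX.iIndep
    (S := {u}) (T := {v : List ℕ | v.length < u.length}) (by simp)
  rw [IndepFun_iff_Indep]
  refine indep_of_indep_of_le_left (indep_of_indep_of_le_right h1
    (measurable_birthTime_iSup X u).comap_le) ?_
  refine Measurable.comap_le ((measurable_pi_apply i).comp ?_)
  refine Measurable.mono (comap_measurable (X u)) ?_ le_rfl
  exact le_iSup₂_of_le u (by simp) le_rfl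

theorem map_birthTime_of_measurable [IsProbabilityMeasure μ] {X : List ℕ → Ω → ℕ → ℝ}
    (hm : ∀ u, Measurable (X u)) (hX : iIndepFun X μ) {τ : ℕ → Measure ℝ}
    (hτ : ∀ u i, μ.map (fun ω => X u ω i) = τ i) (u : List ℕ) :
    Measurable (birthTime X u) ∧ μ.map (birthTime X u) = wordLaw τ u := by
  induction u with
  | nil =>
    refine ⟨measurable_const, ?_⟩
    change μ.map (fun _ => (0 : ℝ)) = Measure.dirac 0
    simp
  | cons i u ih =>
    have hi : Measurable fun ω => X u ω i := (measurable_pi_apply i).comp (hm u)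
    have h1 : birthTime X (i :: u) = (fun ω => X u ω i) + birthTime X u := by
      ext ω; simp [birthTime, add_comm]
    rw [h1, (indepFun_birthTime hm hX u i).map_add_eq_map_conv_map hi ih.1, hτ, ih.2]
    exact ⟨hi.add ih.1, rfl⟩

/-- The σ-algebra argument needs genuine measurability, so the processes are replaced by measurable
versions, which changes neither laws nor independence. -/
theorem map_birthTime [IsProbabilityMeasure μ] {X : List ℕ → Ω → ℕ → ℝ}
    (hm : ∀ u, AEMeasurable (X u) μ) (hX : iIndepFun X μ) {τ : ℕ → Measure ℝ}
    (hτ : ∀ u i, μ.map (fun ω => X u ω i) = τ i) (u : List ℕ) :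
    AEMeasurable (birthTime X u) μ ∧ μ.map (birthTime X u) = wordLaw τ u := by
  have hae : ∀ u, X u =ᵐ[μ] (hm u).mk := fun u => (hm u).ae_eq_mk
  have hb := birthTime_congr hae u
  obtain ⟨h1, h2⟩ := map_birthTime_of_measurable (fun u => (hm u).measurable_mk) (hX.congr hae)
    (τ := τ) (fun u i => by
      rw [← hτ u i]
      refine (Measure.map_congr ?_).symm
      filter_upwards [hae u] with ω h
      rw [h]) u
  exact ⟨⟨_, h1, hb⟩, by rw [Measure.map_congr hb, h2]⟩

theorem meanCount_eq_tsum {X : List ℕ → Ω → ℕ → ℝ}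
    (hm : ∀ u, AEMeasurable (birthTime X u) μ) (j : ℕ) (t : ℝ) :
    meanCount μ X j t =
      ∑' u : {u : List ℕ // u.length = j}, (μ.map (birthTime X u)) (Set.Iic t) := by
  have h1 : ∀ ω, (generationCount X j t ω : ℝ≥0∞) = ∑' u : {u : List ℕ // u.length = j},
      (birthTime X u ⁻¹' Set.Iic t).indicator 1 ω := by
    intro ω
    rw [generationCount, ← ENNReal.tsum_set_one, tsum_subtype _ (fun _ => (1 : ℝ≥0∞))]
    refine (tsum_congr fun u => ?_).trans (tsum_subtype {u : List ℕ | u.length = j}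
      (fun u => (birthTime X u ⁻¹' Set.Iic t).indicator (1 : Ω → ℝ≥0∞) ω)).symm
    by_cases h1 : u.length = j <;> by_cases h2 : birthTime X u ω ≤ t <;>
      simp [Set.indicator, h1, h2]
  unfold meanCount
  simp_rw [h1]
  have h2 : ∀ u, NullMeasurableSet (birthTime X u ⁻¹' Set.Iic t) μ := fun u =>
    (hm u).nullMeasurableSet_preimage measurableSet_Iic
  have h3 : ∀ u, AEMeasurable ((birthTime X u ⁻¹' Set.Iic t).indicator (1 : Ω → ℝ≥0∞)) μ :=
    fun u => (measurable_one.aemeasurable).indicator₀ (h2 u)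
  rw [lintegral_tsum fun u : {u : List ℕ // u.length = j} => h3 u.1]
  refine tsum_congr fun u => ?_
  rw [lintegral_indicator_one₀ (h2 u.1), Measure.map_apply_of_aemeasurable (hm u.1) measurableSet_Iic]

end Birth

section Walk

variable {Ω : Type*} [MeasurableSpace Ω] {μ : Measure Ω} [IsProbabilityMeasure μ]

theorem map_perturbedWalk {ξs ηs : ℕ → Ω → ℝ}
    (hm : ∀ i, AEMeasurable (fun ω => (ξs i ω, ηs i ω)) μ)
    (hind : iIndepFun (fun i ω => (ξs i ω, ηs i ω)) μ) {F G : Measure ℝ} [IsProbabilityMeasure F]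
    (hF : ∀ i, μ.map (ξs i) = F) (hG : ∀ i, μ.map (ηs i) = G) (i : ℕ) :
    μ.map (fun ω => perturbedWalk ξs ηs ω i) = pointLaw F G i := by
  have hξ : ∀ i, AEMeasurable (ξs i) μ := fun i => measurable_fst.comp_aemeasurable (hm i)
  have hη : ∀ i, AEMeasurable (ηs i) μ := fun i => measurable_snd.comp_aemeasurable (hm i)
  have hS : ∀ i, AEMeasurable (fun ω => ∑ k ∈ Finset.range i, ξs k ω) μ := fun i =>
    Finset.aemeasurable_fun_sum _ fun k _ => hξ k
  -- The partial sum uses only pairs with index below i. Projecting the i-th pair to ξ drives the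
  -- induction for the sums; projecting it to η gives the law of T_i, whatever the dependence within
  -- a pair.
  have hpair : ∀ i, IndepFun (fun ω => ∑ k ∈ Finset.range i, ξs k ω)
      (fun ω => (ξs i ω, ηs i ω)) μ := by
    intro i
    have h1 := hind.indepFun_finset₀ (Finset.range i) {i} (by simp) hm
    have h2 := h1.comp
      (by fun_prop : Measurable fun w : Finset.range i → ℝ × ℝ => ∑ k, (w k).1)
      (by fun_prop : Measurable fun w : ({i} : Finset ℕ) → ℝ × ℝ => w ⟨i, Finset.mem_singleton_self i⟩)
    refine h2.congr (Eventually.of_forall fun ω => ?_) (Eventually.of_forall fun ω => rfl)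
    exact Finset.sum_coe_sort (Finset.range i) fun k => ξs k ω
  have hlaw : ∀ i, μ.map (fun ω => ∑ k ∈ Finset.range i, ξs k ω) = convPow F i := by
    intro i
    induction i with
    | zero => simp [convPow]
    | succ i ih =>
      have h1 : (fun ω => ∑ k ∈ Finset.range (i + 1), ξs k ω) =
          (ξs i) + fun ω => ∑ k ∈ Finset.range i, ξs k ω := by
        ext ω; simp [Finset.sum_range_succ, add_comm]
      have h2 := ((hpair i).comp measurable_id measurable_fst).symm
      rw [h1, IndepFun.map_add_eq_map_conv_map₀ (hξ i) (hS i) h2, hF, ih, convPow]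
  have h2 := (hpair i).comp measurable_id measurable_snd
  have h1 : (fun ω => perturbedWalk ξs ηs ω i) =
      (fun ω => ∑ k ∈ Finset.range i, ξs k ω) + ηs i := rfl
  rw [h1, IndepFun.map_add_eq_map_conv_map₀ (hS i) (hη i) h2, hlaw, hG, pointLaw]

theorem IsBranchingProcess.meanCount_eq {ξ η : Ω → ℝ} {ξs ηs : ℕ → Ω → ℝ}
    {X : List ℕ → Ω → ℕ → ℝ} (hX : IsBranchingProcess μ ξ η ξs ηs X) (j : ℕ) (t : ℝ) :
    meanCount μ X j t = convPow (intensity (μ.map ξ) (μ.map η)) j (Set.Iic t) := by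
  have hpair := (hX.steps_identDistrib 0).aemeasurable_snd
  have hξ : AEMeasurable ξ μ := measurable_fst.comp_aemeasurable hpair
  have hF : IsProbabilityMeasure (μ.map ξ) := Measure.isProbabilityMeasure_map hξ
  have hτ : ∀ u i, μ.map (fun ω => X u ω i) = pointLaw (μ.map ξ) (μ.map η) i := by
    intro u i
    have h1 := ((hX.offspring_identDistrib u).comp (measurable_pi_apply i)).map_eq
    refine h1.trans (map_perturbedWalk (fun i => (hX.steps_identDistrib i).aemeasurable_fst)
      hX.steps_indep (fun i => ?_) (fun i => ?_) i)
    · exact ((hX.steps_identDistrib i).comp measurable_fst).map_eq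
    · exact ((hX.steps_identDistrib i).comp measurable_snd).map_eq
  have hb := map_birthTime (fun u => (hX.offspring_identDistrib u).aemeasurable_fst)
    hX.offspring_indep hτ
  rw [meanCount_eq_tsum fun u => (hb u).1, intensity, ← sum_wordLaw,
    Measure.sum_apply _ measurableSet_Iic]
  exact tsum_congr fun u => by rw [(hb u.1).2]

end Walk

/-! ### Induction over generations and the conclusion -/

/-- Two-term expansion of the convolution powers of the intensity measure. -/
theorem tendsto_convPow_intensity {F G : Measure ℝ} [IsProbabilityMeasure F]
    [IsProbabilityMeasure G] (hF : ∀ᵐ x ∂F, 0 < x) (hG : ∀ᵐ x ∂G, 0 < x)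
    (hF2 : Integrable (fun x : ℝ => x ^ 2) F) (hG1 : Integrable (fun x : ℝ => x) G)
    (hnl : ∀ d : ℝ, 0 < d → ¬ ∀ᵐ x ∂F, ∃ n : ℕ, x = n * d) {m b : ℝ} (hm : m = ∫ x, x ∂F)
    (hb : b = m⁻¹ * ((∫ x, x ^ 2 ∂F) / (2 * m) - ∫ y, y ∂G)) (k : ℕ) :
    Tendsto (fun t : ℝ => ((convPow (intensity F G) (k + 1)).real (Set.Iic t) -
        1 / ((k + 1)! * m ^ (k + 1)) * t ^ (k + 1)) / t ^ k) atTop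
      (𝓝 (b * (k + 1) / (k ! * m ^ k))) := by
  have hren := isRenewal_intensity hF hG hF2 hG1
  have hm0 : 0 < m := hm ▸ hren.mean_pos
  have hexc := hren.tendsto_excess hnl
  rw [← hm, ← hb] at hexc
  have hF0 : ∀ᵐ x ∂F, 0 ≤ x := hF.mono fun x hx => hx.le
  have hG0 : ∀ᵐ x ∂G, 0 ≤ x := hG.mono fun x hx => hx.le
  have hν0 := ae_nonneg_intensity hF0 hG0
  have hfin : ∀ j t, convPow (intensity F G) j (Set.Iic t) < ∞ := fun j =>
    measure_Iic_lt_top (laplaceOne_convPow_intensity_lt_top hF hG j)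
  induction k with
  | zero =>
    have h1 : convPow (intensity F G) 1 = intensity F G := by simp [convPow]
    simp only [zero_add, h1]
    have h2 : b * ((0 : ℕ) + 1) / ((0)! * m ^ 0) = b := by simp
    rw [h2]
    refine hexc.congr' ?_
    filter_upwards [eventually_ge_atTop 0] with t ht
    simp only [excess, max_eq_left ht, ← hm]
    simp
    ring
  | succ k ih =>
    have h1 := hren.tendsto_conv (measure_Iic_lt_top (laplaceOne_intensity_lt_top hF hG)) hν0
      (fun _ => rfl) hexc k (f := fun t => (convPow (intensity F G) (k + 1)).real (Set.Iic t))
      (fun s t hst => measureReal_mono (Set.Iic_subset_Iic.2 hst) (hfin _ t).ne)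
      (fun s => measureReal_nonneg) ih
    have hfac : ((k + 1 + 1)! : ℝ) = (k + 2) * (k + 1)! := by
      rw [Nat.factorial_succ]; push_cast; ring
    have hfac' : ((k + 1)! : ℝ) = (k + 1) * k ! := by
      rw [Nat.factorial_succ]; push_cast; ring
    have hk : (0 : ℝ) < k ! := by positivity
    -- With the common factor b/((k+1)! m^(k+1)), the new convolution factor contributes 1 and the
    -- inherited second-order term contributes k+1.
    have hlim : 1 / ((k + 1)! * m ^ (k + 1)) * b + b * (k + 1) / (k ! * m ^ k) / ((k + 1) * ∫ x, x ∂F)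
        = b * ((k + 1 : ℕ) + 1) / ((k + 1)! * m ^ (k + 1)) := by
      rw [← hm, hfac']
      push_cast
      field_simp
      ring
    rw [hlim] at h1
    refine h1.congr fun t => ?_
    rw [← conv_real_Iic (ae_nonneg_convPow hν0 (k + 1)) (hfin (k + 1)), ← hm,
      show convPow (intensity F G) (k + 1 + 1) = intensity F G ∗ convPow (intensity F G) (k + 1)
        from rfl, hfac, pow_succ m (k + 1)]
    congr 2
    field_simp

end IteratedPerturbedWalk

theorem mainTheorem5 {Ω : Type*} [MeasurableSpace Ω] (μ : Measure Ω) [IsProbabilityMeasure μ]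
    (ξ η : Ω → ℝ) (ξs ηs : ℕ → Ω → ℝ) (X : List ℕ → Ω → ℕ → ℝ)
    (hX : IteratedPerturbedWalk.IsBranchingProcess μ ξ η ξs ηs X)
    (hξ_pos : ∀ᵐ ω ∂μ, 0 < ξ ω) (hη_pos : ∀ᵐ ω ∂μ, 0 < η ω)
    (hξ_nonlattice : IteratedPerturbedWalk.Nonlattice μ ξ)
    (hξ_sq : Integrable (fun ω => ξ ω ^ 2) μ) (hη_int : Integrable η μ)
    (m : ℝ) (hm : m = ∫ ω, ξ ω ∂μ) (b : ℝ) (hb : b = IteratedPerturbedWalk.bV μ ξ η)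
    (j : ℕ) (hj : 1 ≤ j) :
    (∀ t : ℝ, IteratedPerturbedWalk.meanCount μ X j t < ∞) ∧
    (Integrable ξ μ ∧ 0 < m) ∧
    Tendsto (fun t : ℝ =>
        ((IteratedPerturbedWalk.meanCount μ X j t).toReal - t ^ j / (j ! * m ^ j)) / t ^ (j - 1))
      atTop (𝓝 (b * j / ((j - 1)! * m ^ (j - 1)))) ∧
    (b ≠ 0 →
      Tendsto (fun t : ℝ =>
          ((IteratedPerturbedWalk.meanCount μ X j t).toReal - t ^ j / (j ! * m ^ j)) /
            (b * j * t ^ (j - 1) / ((j - 1)! * m ^ (j - 1))))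
        atTop (𝓝 1)) := by
  have hpair := (hX.steps_identDistrib 0).aemeasurable_snd
  have hξm : AEMeasurable ξ μ := measurable_fst.comp_aemeasurable hpair
  have hηm : AEMeasurable η μ := measurable_snd.comp_aemeasurable hpair
  have : IsProbabilityMeasure (μ.map ξ) := Measure.isProbabilityMeasure_map hξm
  have : IsProbabilityMeasure (μ.map η) := Measure.isProbabilityMeasure_map hηm
  have hF : ∀ᵐ x ∂(μ.map ξ), 0 < x := (ae_map_iff hξm measurableSet_Ioi).2 hξ_pos
  have hG : ∀ᵐ x ∂(μ.map η), 0 < x := (ae_map_iff hηm measurableSet_Ioi).2 hη_pos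
  have hF2 : Integrable (fun x : ℝ => x ^ 2) (μ.map ξ) :=
    (integrable_map_measure (by fun_prop) hξm).2 hξ_sq
  have hG1 : Integrable (fun x : ℝ => x) (μ.map η) :=
    (integrable_map_measure (by fun_prop) hηm).2 hη_int
  have hm' : m = ∫ x, x ∂(μ.map ξ) := by rw [hm, integral_map hξm (by fun_prop)]
  have hb' : b = m⁻¹ * ((∫ x, x ^ 2 ∂(μ.map ξ)) / (2 * m) - ∫ y, y ∂(μ.map η)) := by
    rw [hb, IteratedPerturbedWalk.bV, ← hm, integral_map hξm (by fun_prop),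
      integral_map hηm (by fun_prop)]
  have hnl : ∀ d : ℝ, 0 < d → ¬ ∀ᵐ x ∂(μ.map ξ), ∃ n : ℕ, x = n * d := fun d hd hcon =>
    hξ_nonlattice d hd (ae_of_ae_map hξm hcon)
  have hren := IteratedPerturbedWalk.isRenewal_intensity hF hG hF2 hG1
  have hm0 : 0 < m := hm' ▸ hren.mean_pos
  have hlim : Tendsto (fun t : ℝ =>
      ((IteratedPerturbedWalk.meanCount μ X j t).toReal - t ^ j / (j ! * m ^ j)) / t ^ (j - 1))
      atTop (𝓝 (b * j / ((j - 1)! * m ^ (j - 1)))) := by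
    obtain ⟨k, rfl⟩ := Nat.exists_eq_add_of_le' hj
    have h1 := IteratedPerturbedWalk.tendsto_convPow_intensity hF hG hF2 hG1 hnl hm' hb' k
    rw [Nat.add_sub_cancel, Nat.cast_add, Nat.cast_one]
    refine h1.congr fun t => ?_
    rw [hX.meanCount_eq, measureReal_def, one_div_mul_eq_div]
  refine ⟨fun t => ?_, ⟨(integrable_map_measure (by fun_prop) hξm).1 hren.step_int, hm0⟩, hlim,
    fun hb0 => ?_⟩
  · rw [hX.meanCount_eq]
    exact IteratedPerturbedWalk.measure_Iic_lt_top
      (IteratedPerturbedWalk.laplaceOne_convPow_intensity_lt_top hF hG j) t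
  · have hj0 : (j : ℝ) ≠ 0 := by positivity
    have hL : b * j / ((j - 1)! * m ^ (j - 1)) ≠ 0 := by positivity
    have h1 := hlim.div_const (b * j / ((j - 1)! * m ^ (j - 1)))
    rw [div_self hL] at h1
    refine h1.congr fun t => ?_
    rw [div_div]
    congr 1
    ring
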